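/- **Model.** There are $n$ agents and periods $t=1,2,\dots$. A state $\theta\in\{0,1\}$ is fixed before play. In every period each agent plays a risky action $r$ or a safe action $s$. The safe action pays $0$. The risky action pays, independently across agents and periods conditional on $\theta$: if $\theta=1$, $X_h>0$ (a success) with probability $\pi$ and $X_l<0$ (a failure) with probability $1-\pi$; if $\theta=0$, always $X_l$. Here $0<\pi<1$, payoffs are discounted by $\delta\in(0,1)$, $E_1=\pi X_h+(1-\pi)X_l>0$ and $E_0=-X_l>0$. Agents observe all past actions but only their own payoffs. Agent $i$ has a prior $p_i\in(0,1)$ that $\theta=1$; the profile $p=(p_1,\dots,p_n)$ is commonly known and may be heterogeneous. A weak perfect Bayesian equilibrium (for $p$) is a profile of behaviour strategies for which there are beliefs at all information sets such that each agent's strategy is optimal at each of her information sets given her belief there and the others' strategies, and such that her beliefs follow by Bayes' rule from her own prior and the strategies at every information set reached with positive probability. A *cascade equilibrium* is a weak perfect Bayesian equilibrium for which there are finite cutoffs $\tau_i\ge 1$ such that on the equilibrium path: (1) agent $i$ plays $r$ in all periods $t<\tau_i$; (2) if all agents $j$ with $\tau_j<\tau_i$ have switched to $s$ at their cutoffs $\tau_j$,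 then at $t=\tau_i$ agent $i$ plays $s$ if she has received $X_l$ in every period in which she played $r$, and $r$ otherwise; an agent who has switched to $s$ keeps playing $s$ as long as every agent whose cutoff has passed has switched at that cutoff; (3) if some agent $j$ plays $r$ at $t=\tau_j$, all agents play $r$ forever from $t=\tau_j+1$ on. Let $$p^a=\frac{(1-\delta)E_0}{(1-\delta)(E_1+E_0)+\delta\pi E_1}$$ be the belief at which an agent exploring alone is indifferent between exploring one more period and stopping forever. Call a prior $q\in(0,1)$ *generic* if $$\frac{q(1-\pi)^k}{q(1-\pi)^k+1-q}\ne p^a\qquad\text{for all } k=0,1,2,\dots,$$ i.e. after no number of failures is an agent with prior $q$ exactly indifferent. **Proposition 2.** Suppose that $$\frac{E_1}{E_0}\ \ge\ \frac{1-\pi}{\delta+\pi-(1-\pi)\left(1+\frac{\delta\pi}{1-\delta}\right)}.\tag{1}$$ Then all but countably many $q\in(0,1)$ are generic, and for every generic $q\in(0,1)$ there is an open ball around the common prior profile $(q,\dots,q)$ in $\mathbb R^n$, contained in $(0,1)^n$, such that for every prior profile $p$ in this ball there is a cascade equilibrium with priors $p$. -/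

import Mathlib

open scoped BigOperators

namespace SocialBandit

/-- The two states of the world: `good` is `θ = 1`, `bad` is `θ = 0`. -/
inductive State
  | good
  | bad
  deriving DecidableEq

/-- The two actions available in every period. -/
inductive Act
  | risky
  | safe
  deriving DecidableEq

/-- What happens to one agent in one period: she plays safe, or she plays risky and draws the
high payoff, or she plays risky and draws the low payoff. -/
inductive Outcome
  | safe
  | high
  | low
  deriving DecidableEq

instance : Fintype State :=
  ⟨{.good, .bad}, fun x => by cases x <;> simp⟩

instance : Fintype Outcome :=
  ⟨{.safe, .high, .low}, fun x => by cases x <;> simp⟩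

/-- The (publicly observed) action contained in an outcome. -/
def Outcome.act : Outcome → Act
  | .safe => .safe
  | .high => .risky
  | .low => .risky

/-- The exogenous parameters: success probability `π`, discount factor `δ`, payoffs
`Xl < 0 < Xh`, with a positive mean of the risky action in the good state. -/
structure Params where
  π : ℝ
  δ : ℝ
  Xh : ℝ
  Xl : ℝ
  π_pos : 0 < π
  π_lt_one : π < 1
  δ_pos : 0 < δ
  δ_lt_one : δ < 1
  Xh_pos : 0 < Xh
  Xl_neg : Xl < 0
  mean_pos : 0 < π * Xh + (1 - π) * Xl

/-- A complete history of past play, the most recent period first. After the history `h` the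
current period is `h.length + 1`. -/
abbrev History (n : ℕ) := List (Fin n → Outcome)

/-- What one agent knows about the past (the most recent period first): the actions of all
agents and her own outcomes. -/
abbrev Info (n : ℕ) := List ((Fin n → Act) × Outcome)

/-- The information of agent `i` after the history `h`. -/
def observe {n : ℕ} (i : Fin n) (h : History n) : Info n :=
  h.map fun o => (fun j => (o j).act, o i)

/-- The finite set of all histories of length `t`. -/
def histories (n : ℕ) : ℕ → Finset (History n)
  | 0 => {[]}
  | t + 1 => (Finset.univ ×ˢ histories n t).image fun x => x.1 :: x.2

theorem mem_histories {n : ℕ} (t : ℕ) (h : History n) :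
    h ∈ histories n t ↔ h.length = t := by
  induction t generalizing h with
  | zero => simp [histories]
  | succ t ih => cases h <;> simp [histories, ih]

/-- A behaviour strategy profile: after each information, the probability of playing risky. -/
abbrev Profile (n : ℕ) := Fin n → Info n → unitInterval

/-- A belief system: for every agent and every information, weights on the pairs of a state
and a complete history. Only the weights on the nodes of the information set matter. -/
abbrev BeliefSystem (n : ℕ) := Fin n → Info n → State × History n → ℝ

/-- The action that agent `j` played in period `t` of the history `h` (`none` if `t` is not one
of the periods `1, …, h.length`). -/
def actAt {n : ℕ} (j : Fin n) : History n → ℕ → Option Act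
  | [], _ => none
  | o :: h, t => if t = h.length + 1 then some (o j).act else actAt j h t

/-- Agent `i` has received the low payoff in every past period in which she played risky. -/
def AllFailures {n : ℕ} (i : Fin n) (h : History n) : Prop :=
  ∀ o ∈ h, o i ≠ Outcome.high

namespace Params

variable (M : Params)

/-- Expected payoff of the risky action in the good state. -/
def E1 : ℝ := M.π * M.Xh + (1 - M.π) * M.Xl

/-- Expected loss (a positive number) of the risky action in the bad state. -/
def E0 : ℝ := -M.Xl

/-- The belief at which an agent exploring alone is indifferent between exploring one more
period and stopping forever. -/
noncomputable def cutoffBelief : ℝ :=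
  (1 - M.δ) * M.E0 / ((1 - M.δ) * (M.E1 + M.E0) + M.δ * M.π * M.E1)

/-- The posterior probability of the good state after `k` draws, all of them failures, when the
prior is `q` (Bayes' rule). -/
noncomputable def failureBelief (k : ℕ) (q : ℝ) : ℝ :=
  q * (1 - M.π) ^ k / (q * (1 - M.π) ^ k + (1 - q))

/-- The prior `q` is generic: after no number of failures is an agent with prior `q` exactly
indifferent between one more exploration and stopping. -/
def IsGeneric (q : ℝ) : Prop :=
  ∀ k : ℕ, M.failureBelief k q ≠ M.cutoffBelief

/-- The prior probability of each state for an agent who gives `θ = 1` probability `q`. -/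
def priorWeight (q : ℝ) : State → ℝ
  | .good => q
  | .bad => 1 - q

/-- The payoff of each outcome. -/
def payoff : Outcome → ℝ
  | .safe => 0
  | .high => M.Xh
  | .low => M.Xl

/-- Probability of a success of the risky action in each state. -/
def successProb : State → ℝ
  | .good => M.π
  | .bad => 0

/-- Probability of an outcome, in a given state, given the action contained in it. -/
def chance (θ : State) : Outcome → ℝ
  | .safe => 1
  | .high => M.successProb θ
  | .low => 1 - M.successProb θ

/-- Probability of an outcome for an agent who plays risky with probability `x`. -/
def outcomeProb (x : ℝ) (θ : State) : Outcome → ℝ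
  | .safe => 1 - x
  | .high => x * M.successProb θ
  | .low => x * (1 - M.successProb θ)

variable {n : ℕ}

/-- Probability that the profile of outcomes `o` occurs in the period after the history `h`:
given the state and the past, the agents' randomizations and draws are independent. -/
def stepProb (σ : Profile n) (θ : State) (h : History n) (o : Fin n → Outcome) : ℝ :=
  ∏ j, M.outcomeProb (σ j (observe j h)) θ (o j)

/-- Probability that the history `h` occurs, in the state `θ`, under the profile `σ`. -/
def reachProb (σ : Profile n) (θ : State) : History n → ℝ
  | [] => 1
  | o :: h => reachProb σ θ h * M.stepProb σ θ h o

/-- Expected payoff of agent `i` in the period that comes `s` periods after the current one,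
given the state `θ` and the past `h`. -/
def stageValue (σ : Profile n) (i : Fin n) (θ : State) : ℕ → History n → ℝ
  | 0, h => ∑ o, M.stepProb σ θ h o * M.payoff (o i)
  | s + 1, h => ∑ o, M.stepProb σ θ h o * stageValue σ i θ s (o :: h)

/-- Normalized expected discounted payoff of agent `i` from the current period on, given the
state `θ` and the past `h`. -/
noncomputable def value (σ : Profile n) (i : Fin n) (θ : State) (h : History n) : ℝ :=
  (1 - M.δ) * ∑' s : ℕ, M.δ ^ s * M.stageValue σ i θ s h

/-- The node `(θ, h)` belongs to the game tree: every draw in `h` is possible in state `θ`. -/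
def IsNode (θ : State) (h : History n) : Prop :=
  ∀ o ∈ h, ∀ j, 0 < M.chance θ (o j)

open Classical in
/-- The information set of agent `i` with information `I`: all nodes of the game tree at which
she has the information `I`. -/
noncomputable def infoSet (i : Fin n) (I : Info n) : Finset (State × History n) :=
  (Finset.univ ×ˢ histories n I.length).filter
    fun x => M.IsNode x.1 x.2 ∧ observe i x.2 = I

/-- Probability, computed with the prior `q` for the good state, that the information set of
agent `i` with information `I` is reached under `σ`. -/
noncomputable def infoProb (q : ℝ) (σ : Profile n) (i : Fin n) (I : Info n) : ℝ :=
  ∑ x ∈ M.infoSet i I, priorWeight q x.1 * M.reachProb σ x.1 x.2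

/-- Expected continuation payoff of agent `i` at the information `I` with the belief `b`. -/
noncomputable def expectedValue (σ : Profile n) (i : Fin n) (I : Info n)
    (b : State × History n → ℝ) : ℝ :=
  ∑ x ∈ M.infoSet i I, b x * M.value σ i x.1 x.2

/-- `μ` is a system of beliefs: a probability distribution on each information set. -/
def IsBeliefSystem (μ : BeliefSystem n) : Prop :=
  ∀ i I, (M.infoSet i I).Nonempty →
    (∀ x ∈ M.infoSet i I, 0 ≤ μ i I x) ∧ ∑ x ∈ M.infoSet i I, μ i I x = 1

/-- Each agent's beliefs follow from her own prior and `σ` by Bayes' rule at every information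
set that is reached with positive probability. -/
def IsBayesConsistent (p : Fin n → ℝ) (σ : Profile n) (μ : BeliefSystem n) : Prop :=
  ∀ i I, 0 < M.infoProb (p i) σ i I → ∀ x ∈ M.infoSet i I,
    μ i I x = priorWeight (p i) x.1 * M.reachProb σ x.1 x.2 / M.infoProb (p i) σ i I

/-- At every information set, on and off the path of play, no strategy of the agent who moves
does better than her own against the strategies of the others, given her belief there. -/
def IsSequentiallyRational (σ : Profile n) (μ : BeliefSystem n) : Prop :=
  ∀ i I, (M.infoSet i I).Nonempty → ∀ s : Info n → unitInterval,
    M.expectedValue (Function.update σ i s) i I (μ i I) ≤ M.expectedValue σ i I (μ i I)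

/-- `(σ, μ)` is a weak perfect Bayesian equilibrium for the (commonly known) priors `p`. -/
def IsWeakPBE (p : Fin n → ℝ) (σ : Profile n) (μ : BeliefSystem n) : Prop :=
  M.IsBeliefSystem μ ∧ M.IsBayesConsistent p σ μ ∧ M.IsSequentiallyRational σ μ

/-- The history `h` is on the path of play of `σ`. -/
def OnPath (σ : Profile n) (h : History n) : Prop :=
  ∃ θ, 0 < M.reachProb σ θ h

/-- On the path of play, `σ` induces the cascade outcome with the cutoffs `τ`. -/
structure InducesCascade (σ : Profile n) (τ : Fin n → ℕ) : Prop where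
  one_le : ∀ i, 1 ≤ τ i
  /-- Before her cutoff every agent plays risky. -/
  before : ∀ h, M.OnPath σ h → ∀ i, h.length + 1 < τ i → σ i (observe i h) = 1
  /-- At her cutoff, if all agents with earlier cutoffs have switched to safe, an agent plays
  safe if she has had only failures, -/
  switch : ∀ h, M.OnPath σ h → ∀ i, h.length + 1 = τ i →
    (∀ j, τ j < τ i → actAt j h (τ j) = some Act.safe) →
    AllFailures i h → σ i (observe i h) = 0
  /-- and goes on playing risky otherwise. -/
  noSwitch : ∀ h, M.OnPath σ h → ∀ i, h.length + 1 = τ i →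
    (∀ j, τ j < τ i → actAt j h (τ j) = some Act.safe) →
    ¬ AllFailures i h → σ i (observe i h) = 1
  /-- An agent who has switched to safe stays there as long as every agent whose cutoff has
  passed has switched at that cutoff. -/
  stay : ∀ h, M.OnPath σ h → ∀ i, τ i < h.length + 1 →
    (∀ j, τ j < h.length + 1 → actAt j h (τ j) = some Act.safe) → σ i (observe i h) = 0
  /-- If some agent does not switch at her cutoff, all agents play risky ever after. -/
  cascade : ∀ h, M.OnPath σ h → ∀ j, τ j < h.length + 1 →
    actAt j h (τ j) = some Act.risky → ∀ i, σ i (observe i h) = 1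

/-- `σ` is a cascade equilibrium for the priors `p`: a weak perfect Bayesian equilibrium (with
some beliefs) that induces a cascade outcome (with some cutoffs). -/
def IsCascadeEquilibrium (p : Fin n → ℝ) (σ : Profile n) : Prop :=
  (∃ μ, M.IsWeakPBE p σ μ) ∧ ∃ τ, M.InducesCascade σ τ

end Params

end SocialBandit

namespace SocialBandit

/-! All agents share one cutoff. Let `k` be the least number of failures after which an agent with
prior `q`, exploring alone, strictly prefers to stop (`exists_exploreGain_neg`). Genericity makes
each earlier exploration strictly profitable. These are finitely many strict inequalities,
continuous in the prior, so the same `k` solves the solo problem for every prior near `q`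
(`exists_constant_cutoff`).

In `cascadeProfile` everybody explores `k` times and then stops, unless she has had a success or the
public record departs from this pattern; in those cases she plays risky forever. In the bad state
the pattern is followed with probability one. Hence the information of an agent with a conforming
record and no success always has positive probability, and on the path every other information that
can lead to risky play after the cutoff excludes the bad state. Off the path, `optimisticBelief`
puts all weight on the good state, which makes risky play optimal there.

It remains to treat an agent whose record conforms and who has had no success. A visible deviation
makes the others play risky forever, whatever they have seen, so from then on she learns only from
her own draws and gets at most the solo value (`value_le_soloValue`). Conforming gives at least that
value (`soloValue_le_value`), since at the cutoff she may also learn of the others' successes for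
free. The possible successes of others do not spoil the comparison: `exists_deviation_bound` bounds
the gain by a number depending on the state alone, uniformly over the nodes of the information set,
and the average of these numbers under the solo belief is not positive. -/

theorem sum_outcome (f : Outcome → ℝ) : ∑ y, f y = f .safe + f .high + f .low := by
  have : (Finset.univ : Finset Outcome) = {.safe, .high, .low} := rfl
  rw [this]
  simp [add_assoc]

theorem sum_state (f : State → ℝ) : ∑ θ, f θ = f .good + f .bad := by
  have : (Finset.univ : Finset State) = {.good, .bad} := rfl
  rw [this]
  simp

/-- The marginal of a product distribution. -/
theorem sum_prod_mul_apply {n : ℕ} (P : Fin n → Outcome → ℝ) (hP : ∀ j, ∑ y, P j y = 1)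
    (i : Fin n) (g : Outcome → ℝ) :
    ∑ o : Fin n → Outcome, (∏ j, P j (o j)) * g (o i) = ∑ y, P i y * g y := by
  -- Absorbing `g` into the factor of index `i` turns the sum into a product of one-agent sums, all
  -- equal to 1 except that of `i`.
  have h1 : ∀ o : Fin n → Outcome, (∏ j, P j (o j)) * g (o i)
      = ∏ j, P j (o j) * (if j = i then g (o j) else 1) := by
    intro o
    rw [Finset.prod_mul_distrib]
    simp
  simp_rw [h1]
  rw [← Fintype.piFinset_univ, ← Finset.prod_univ_sum (fun _ => Finset.univ)
    (fun j y => P j y * (if j = i then g y else 1)), Finset.prod_eq_single i]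
  · simp
  · intro j _ hj
    simp [hj, hP]
  · simp

theorem sum_histories_succ {n : ℕ} (t : ℕ) (f : History n → ℝ) :
    ∑ h ∈ histories n (t + 1), f h = ∑ h ∈ histories n t, ∑ o, f (o :: h) := by
  rw [histories, Finset.sum_image, Finset.sum_product_right]
  rintro ⟨a, b⟩ _ ⟨c, d⟩ _ h
  simpa using h

/-! ### One-period distributions, values and nodes of the game tree -/

namespace Params

variable (M : Params) {n : ℕ}

theorem E0_pos : 0 < M.E0 := by
  have := M.Xl_neg
  unfold E0
  linarith

theorem E1_pos : 0 < M.E1 := M.mean_pos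

/-- Expected payoff of the risky action in each state. -/
def mean (θ : State) : ℝ := M.successProb θ * M.Xh + (1 - M.successProb θ) * M.Xl

theorem mean_good : M.mean .good = M.E1 := rfl

theorem mean_bad : M.mean .bad = -M.E0 := by simp [mean, E0, successProb]

theorem successProb_nonneg (θ : State) : 0 ≤ M.successProb θ := by
  cases θ <;> simp [successProb, M.π_pos.le]

theorem successProb_lt_one (θ : State) : M.successProb θ < 1 := by
  cases θ <;> simp [successProb, M.π_lt_one]

theorem sum_outcomeProb (x : ℝ) (θ : State) : ∑ y, M.outcomeProb x θ y = 1 := by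
  rw [sum_outcome]
  simp only [outcomeProb]
  ring

theorem outcomeProb_nonneg (x : unitInterval) (θ : State) (y : Outcome) :
    0 ≤ M.outcomeProb x θ y := by
  have h1 := x.2.1
  have h2 := x.2.2
  have h3 := M.successProb_nonneg θ
  have h4 := (M.successProb_lt_one θ).le
  cases y <;> simp only [outcomeProb]
  · linarith
  · positivity
  · exact mul_nonneg h1 (by linarith)

theorem act_of_outcomeProb_one {θ : State} {y : Outcome}
    (h : M.outcomeProb ((1 : unitInterval) : ℝ) θ y ≠ 0) : y.act = .risky := by
  cases y <;> simp_all [outcomeProb, Outcome.act]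

theorem eq_safe_of_outcomeProb_zero {θ : State} {y : Outcome}
    (h : M.outcomeProb ((0 : unitInterval) : ℝ) θ y ≠ 0) : y = .safe := by
  cases y <;> simp_all [outcomeProb]

theorem chance_pos_of_outcomeProb {θ : State} {y : Outcome} {x : ℝ}
    (h : M.outcomeProb x θ y ≠ 0) : 0 < M.chance θ y := by
  have h3 := M.successProb_nonneg θ
  have h4 := M.successProb_lt_one θ
  cases y <;> simp only [outcomeProb, chance] at *
  · exact one_pos
  · exact lt_of_le_of_ne h3 (fun e => h (by rw [← e]; simp))
  · linarith

theorem chance_good_pos (y : Outcome) : 0 < M.chance .good y := by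
  have h3 := M.π_pos
  have h4 := M.π_lt_one
  cases y <;> simp only [chance, successProb] <;> linarith

theorem ne_high_of_chance_bad {y : Outcome} (h : 0 < M.chance .bad y) : y ≠ .high := by
  rintro rfl
  simp [chance, successProb] at h

theorem stepProb_nonneg (σ : Profile n) (θ : State) (h : History n) (o : Fin n → Outcome) :
    0 ≤ M.stepProb σ θ h o :=
  Finset.prod_nonneg fun _ _ => M.outcomeProb_nonneg _ _ _

theorem outcomeProb_ne_zero_of_stepProb {σ : Profile n} {θ : State} {h : History n}
    {o : Fin n → Outcome} (ho : M.stepProb σ θ h o ≠ 0) (j : Fin n) :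
    M.outcomeProb (σ j (observe j h)) θ (o j) ≠ 0 :=
  Finset.prod_ne_zero_iff.mp ho j (Finset.mem_univ j)

theorem sum_stepProb_mul_apply (σ : Profile n) (θ : State) (h : History n) (i : Fin n)
    (g : Outcome → ℝ) :
    ∑ o, M.stepProb σ θ h o * g (o i)
      = ∑ y, M.outcomeProb (σ i (observe i h)) θ y * g y :=
  sum_prod_mul_apply (fun j y => M.outcomeProb (σ j (observe j h)) θ y)
    (fun _ => M.sum_outcomeProb _ _) i g

theorem sum_stepProb (σ : Profile n) (θ : State) (h : History n) :
    ∑ o, M.stepProb σ θ h o = 1 := by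
  have := Finset.prod_univ_sum (fun _ : Fin n => (Finset.univ : Finset Outcome))
    (fun j y => M.outcomeProb (σ j (observe j h)) θ y)
  rw [Fintype.piFinset_univ] at this
  unfold stepProb
  rw [← this]
  simp [sum_outcomeProb]

theorem expect_mono (σ : Profile n) (θ : State) (h : History n) {f g : (Fin n → Outcome) → ℝ}
    (hfg : ∀ o, M.stepProb σ θ h o ≠ 0 → f o ≤ g o) :
    ∑ o, M.stepProb σ θ h o * f o ≤ ∑ o, M.stepProb σ θ h o * g o := by
  refine Finset.sum_le_sum fun o _ => ?_
  by_cases ho : M.stepProb σ θ h o = 0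
  · simp [ho]
  · exact mul_le_mul_of_nonneg_left (hfg o ho) (M.stepProb_nonneg σ θ h o)

theorem expect_const (σ : Profile n) (θ : State) (h : History n) (c : ℝ) :
    ∑ o, M.stepProb σ θ h o * c = c := by
  rw [← Finset.sum_mul, sum_stepProb, one_mul]

theorem expect_risky (σ : Profile n) (θ : State) (h : History n) (i : Fin n)
    (hi : σ i (observe i h) = 1) (g : Outcome → ℝ) :
    ∑ o, M.stepProb σ θ h o * g (o i)
      = M.successProb θ * g .high + (1 - M.successProb θ) * g .low := by
  rw [sum_stepProb_mul_apply, hi, sum_outcome]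
  simp [outcomeProb]

theorem expect_payoff (σ : Profile n) (θ : State) (h : History n) (i : Fin n) :
    ∑ o, M.stepProb σ θ h o * M.payoff (o i) = σ i (observe i h) * M.mean θ := by
  rw [sum_stepProb_mul_apply, sum_outcome]
  simp only [outcomeProb, payoff, mean]
  ring

/-- A deviation mixes the two pure actions of the deviating agent. -/
theorem stepProb_update (σ : Profile n) (i : Fin n) (s : Info n → unitInterval) (θ : State)
    (h : History n) (o : Fin n → Outcome) :
    M.stepProb (Function.update σ i s) θ h o
      = s (observe i h) * M.stepProb (Function.update σ i fun _ => 1) θ h o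
        + (1 - s (observe i h)) * M.stepProb (Function.update σ i fun _ => 0) θ h o := by
  have key : ∀ r : Info n → unitInterval, M.stepProb (Function.update σ i r) θ h o
      = M.outcomeProb (r (observe i h)) θ (o i)
        * ∏ j ∈ Finset.univ.erase i, M.outcomeProb (σ j (observe j h)) θ (o j) := by
    intro r
    unfold stepProb
    rw [← Finset.mul_prod_erase _ _ (Finset.mem_univ i)]
    congr 1
    · simp
    · refine Finset.prod_congr rfl fun j hj => ?_
      rw [Function.update_of_ne (Finset.ne_of_mem_erase hj)]
  rw [key, key, key]
  have : M.outcomeProb (s (observe i h)) θ (o i)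
      = s (observe i h) * M.outcomeProb ((1 : unitInterval) : ℝ) θ (o i)
        + (1 - s (observe i h)) * M.outcomeProb ((0 : unitInterval) : ℝ) θ (o i) := by
    cases o i <;> simp [outcomeProb]
  rw [this]
  ring

theorem stepProb_congr {σ σ' : Profile n} {h h' : History n}
    (H : ∀ j, σ j (observe j h) = σ' j (observe j h')) (θ : State) (o : Fin n → Outcome) :
    M.stepProb σ θ h o = M.stepProb σ' θ h' o := by
  unfold stepProb
  simp_rw [H]

/-! ### Values -/

/-- The sign condition on `c` is needed because the safe action, paying 0, is always available. -/
theorem stageValue_le {σ : Profile n} {i : Fin n} {θ : State} {c : ℝ} (hc : 0 ≤ c)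
    (hm : M.mean θ ≤ c) (s : ℕ) (h : History n) : M.stageValue σ i θ s h ≤ c := by
  induction s generalizing h with
  | zero =>
    rw [stageValue, expect_payoff]
    have h1 := (σ i (observe i h)).2.1
    have h2 := (σ i (observe i h)).2.2
    nlinarith
  | succ s ih =>
    rw [stageValue]
    exact (M.expect_mono σ θ h fun o _ => ih (o :: h)).trans_eq (M.expect_const σ θ h c)

theorem le_stageValue {σ : Profile n} {i : Fin n} {θ : State} {c : ℝ} (hc : c ≤ 0)
    (hm : c ≤ M.mean θ) (s : ℕ) (h : History n) : c ≤ M.stageValue σ i θ s h := by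
  induction s generalizing h with
  | zero =>
    rw [stageValue, expect_payoff]
    have h1 := (σ i (observe i h)).2.1
    have h2 := (σ i (observe i h)).2.2
    nlinarith
  | succ s ih =>
    rw [stageValue]
    exact (M.expect_const σ θ h c).symm.trans_le (M.expect_mono σ θ h fun o _ => ih (o :: h))

theorem summable_stageValue (σ : Profile n) (i : Fin n) (θ : State) (h : History n) :
    Summable fun s : ℕ => M.δ ^ s * M.stageValue σ i θ s h := by
  have hδ := M.δ_pos.le
  refine Summable.of_norm_bounded
    ((summable_geometric_of_lt_one hδ M.δ_lt_one).mul_right |M.mean θ|) fun s => ?_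
  rw [norm_mul, norm_pow, Real.norm_eq_abs, abs_of_nonneg hδ, Real.norm_eq_abs]
  refine mul_le_mul_of_nonneg_left (abs_le.mpr ⟨?_, ?_⟩) (by positivity)
  · exact M.le_stageValue (by simp) (neg_abs_le _) s h
  · exact M.stageValue_le (abs_nonneg _) (le_abs_self _) s h

theorem geometric_const (c : ℝ) : (1 - M.δ) * ∑' s : ℕ, M.δ ^ s * c = c := by
  rw [tsum_mul_right, tsum_geometric_of_lt_one M.δ_pos.le M.δ_lt_one, ← mul_assoc,
    mul_inv_cancel₀ (by linarith [M.δ_lt_one]), one_mul]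

theorem summable_geometric_const (c : ℝ) : Summable fun s : ℕ => M.δ ^ s * c :=
  (summable_geometric_of_lt_one M.δ_pos.le M.δ_lt_one).mul_right c

theorem value_le {σ : Profile n} {i : Fin n} {θ : State} {c : ℝ} (hc : 0 ≤ c)
    (hm : M.mean θ ≤ c) (h : History n) : M.value σ i θ h ≤ c := by
  rw [← M.geometric_const c]
  refine mul_le_mul_of_nonneg_left ?_ (by linarith [M.δ_lt_one])
  exact (M.summable_stageValue σ i θ h).tsum_le_tsum
    (fun s => mul_le_mul_of_nonneg_left (M.stageValue_le hc hm s h) (pow_nonneg M.δ_pos.le s))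
    (M.summable_geometric_const c)

theorem le_value {σ : Profile n} {i : Fin n} {θ : State} {c : ℝ} (hc : c ≤ 0)
    (hm : c ≤ M.mean θ) (h : History n) : c ≤ M.value σ i θ h := by
  rw [← M.geometric_const c]
  refine mul_le_mul_of_nonneg_left ?_ (by linarith [M.δ_lt_one])
  exact (M.summable_geometric_const c).tsum_le_tsum
    (fun s => mul_le_mul_of_nonneg_left (M.le_stageValue hc hm s h) (pow_nonneg M.δ_pos.le s))
    (M.summable_stageValue σ i θ h)

theorem value_good_le (σ : Profile n) (i : Fin n) (h : History n) :
    M.value σ i .good h ≤ M.E1 :=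
  M.value_le M.E1_pos.le M.mean_good.le h

theorem value_good_nonneg (σ : Profile n) (i : Fin n) (h : History n) :
    0 ≤ M.value σ i .good h :=
  M.le_value le_rfl (M.mean_good.symm ▸ M.E1_pos.le) h

theorem value_bad_nonpos (σ : Profile n) (i : Fin n) (h : History n) :
    M.value σ i .bad h ≤ 0 :=
  M.value_le le_rfl (by rw [mean_bad]; linarith [M.E0_pos]) h

theorem value_eq_of_stageValue {σ : Profile n} {i : Fin n} {θ : State} {h : History n} {c : ℝ}
    (H : ∀ s, M.stageValue σ i θ s h = c) : M.value σ i θ h = c := by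
  rw [value]
  simp_rw [H]
  exact M.geometric_const c

/-- The Bellman equation. -/
theorem value_eq (σ : Profile n) (i : Fin n) (θ : State) (h : History n) :
    M.value σ i θ h = ∑ o, M.stepProb σ θ h o *
      ((1 - M.δ) * M.payoff (o i) + M.δ * M.value σ i θ (o :: h)) := by
  have h1 : ∑' s : ℕ, M.δ ^ (s + 1) * M.stageValue σ i θ (s + 1) h
      = ∑ o, M.stepProb σ θ h o * (M.δ * ∑' s : ℕ, M.δ ^ s * M.stageValue σ i θ s (o :: h)) := by
    have h2 : ∀ s : ℕ, M.δ ^ (s + 1) * M.stageValue σ i θ (s + 1) h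
        = ∑ o, M.stepProb σ θ h o * (M.δ * (M.δ ^ s * M.stageValue σ i θ s (o :: h))) := by
      intro s
      rw [stageValue, Finset.mul_sum]
      exact Finset.sum_congr rfl fun o _ => by ring
    simp_rw [h2]
    rw [Summable.tsum_finsetSum fun o _ =>
      (((M.summable_stageValue σ i θ (o :: h)).mul_left _).mul_left _)]
    simp_rw [tsum_mul_left]
  rw [value, (M.summable_stageValue σ i θ h).tsum_eq_zero_add, h1, pow_zero, one_mul, stageValue,
    ← Finset.sum_add_distrib, Finset.mul_sum]
  refine Finset.sum_congr rfl fun o _ => ?_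
  rw [value]
  ring

/-- The Bellman equation for a deviating agent. -/
theorem value_update (σ : Profile n) (i : Fin n) (s : Info n → unitInterval) (θ : State)
    (h : History n) :
    M.value (Function.update σ i s) i θ h
      = s (observe i h) * ∑ o, M.stepProb (Function.update σ i fun _ => 1) θ h o *
          ((1 - M.δ) * M.payoff (o i) + M.δ * M.value (Function.update σ i s) i θ (o :: h))
        + (1 - s (observe i h)) * ∑ o, M.stepProb (Function.update σ i fun _ => 0) θ h o *
          ((1 - M.δ) * M.payoff (o i) + M.δ * M.value (Function.update σ i s) i θ (o :: h)) := by
  rw [value_eq, Finset.mul_sum, Finset.mul_sum, ← Finset.sum_add_distrib]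
  refine Finset.sum_congr rfl fun o _ => ?_
  rw [stepProb_update]
  ring

theorem reachProb_nonneg (σ : Profile n) (θ : State) (h : History n) :
    0 ≤ M.reachProb σ θ h := by
  induction h with
  | nil => simp [reachProb]
  | cons o h ih => exact mul_nonneg ih (M.stepProb_nonneg σ θ h o)

theorem isNode_cons {θ : State} {o : Fin n → Outcome} {h : History n} :
    M.IsNode θ (o :: h) ↔ (∀ j, 0 < M.chance θ (o j)) ∧ M.IsNode θ h := by
  simp [IsNode]

theorem isNode_good (h : History n) : M.IsNode .good h :=
  fun _ _ _ => M.chance_good_pos _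

theorem isNode_cons_of_stepProb {σ : Profile n} {θ : State} {o : Fin n → Outcome} {h : History n}
    (hn : M.IsNode θ h) (ho : M.stepProb σ θ h o ≠ 0) : M.IsNode θ (o :: h) :=
  M.isNode_cons.mpr
    ⟨fun j => M.chance_pos_of_outcomeProb (M.outcomeProb_ne_zero_of_stepProb ho j), hn⟩

theorem mem_infoSet {i : Fin n} {I : Info n} {x : State × History n} :
    x ∈ M.infoSet i I ↔ M.IsNode x.1 x.2 ∧ observe i x.2 = I := by
  simp only [infoSet, Finset.mem_filter, Finset.mem_product, Finset.mem_univ, true_and,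
    mem_histories]
  refine ⟨fun h => h.2, fun h => ⟨?_, h⟩⟩
  rw [← h.2, observe, List.length_map]

end Params

end SocialBandit

/-! ### The cascade profile and its conforming histories -/

namespace SocialBandit

variable {n : ℕ}

/-- The public actions of all agents after a history. -/
def publicActs (h : History n) : List (Fin n → Act) :=
  h.map fun o j => (o j).act

/-- In the first `k` periods everybody has played risky, and safe ever after. -/
def Conforms (k : ℕ) : List (Fin n → Act) → Prop
  | [] => True
  | a :: l => (∀ j, a j = if l.length < k then Act.risky else Act.safe) ∧ Conforms k l

/-- The information at which an agent plays safe once `k` periods have passed: the public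
actions conform with `k` explorations, and she has had no success. -/
def CanStop (k : ℕ) (I : Info n) : Prop :=
  Conforms k (I.map Prod.fst) ∧ ∀ y ∈ I, y.2 ≠ Outcome.high

open Classical in
/-- Every agent explores `k` times and stops after `k` failures, unless somebody deviates or
reveals a success. -/
noncomputable def cascadeProfile (n k : ℕ) : Profile n :=
  fun _ I => if k ≤ I.length ∧ CanStop k I then 0 else 1

/-- The history of `t` periods in which everybody explores `k` times, fails, and then stops. -/
def failureHistory (n k : ℕ) : ℕ → History n
  | 0 => []
  | t + 1 => (fun _ => if t < k then Outcome.low else Outcome.safe) :: failureHistory n k t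

@[simp] theorem length_observe (i : Fin n) (h : History n) : (observe i h).length = h.length := by
  simp [observe]

@[simp] theorem length_publicActs (h : History n) : (publicActs h).length = h.length := by
  simp [publicActs]

@[simp] theorem length_failureHistory (k t : ℕ) : (failureHistory n k t).length = t := by
  induction t with
  | zero => rfl
  | succ t ih => simp [failureHistory, ih]

theorem observe_cons (i : Fin n) (o : Fin n → Outcome) (h : History n) :
    observe i (o :: h) = (fun j => (o j).act, o i) :: observe i h := rfl

theorem publicActs_of_observe {i : Fin n} {h h' : History n} (e : observe i h = observe i h') :
    publicActs h = publicActs h' := by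
  have : ∀ g : History n, publicActs g = (observe i g).map Prod.fst := by
    simp [publicActs, observe]
  rw [this, this, e]

theorem conforms_cons {k : ℕ} {o : Fin n → Outcome} {h : History n} :
    Conforms k (publicActs (o :: h)) ↔
      (∀ j, (o j).act = if h.length < k then Act.risky else Act.safe) ∧
        Conforms k (publicActs h) := by
  rw [← length_publicActs h]
  rfl

theorem not_conforms_cons {k : ℕ} {h : History n} (hc : ¬ Conforms k (publicActs h))
    (o : Fin n → Outcome) : ¬ Conforms k (publicActs (o :: h)) :=
  fun e => hc (conforms_cons.mp e).2

theorem canStop_observe {k : ℕ} {i : Fin n} {h : History n} :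
    CanStop k (observe i h) ↔ Conforms k (publicActs h) ∧ AllFailures i h := by
  simp [CanStop, publicActs, AllFailures, observe, Function.comp_def]

theorem not_canStop_cons {k : ℕ} {i : Fin n} {h : History n} (hc : ¬ CanStop k (observe i h))
    (o : Fin n → Outcome) : ¬ CanStop k (observe i (o :: h)) := by
  rw [canStop_observe] at *
  rintro ⟨h1, h2⟩
  exact hc ⟨(conforms_cons.mp h1).2, fun x hx => h2 x (List.mem_cons_of_mem _ hx)⟩

theorem cascadeProfile_eq_one {k : ℕ} {i : Fin n} {h : History n}
    (hc : ¬ CanStop k (observe i h)) : cascadeProfile n k i (observe i h) = 1 :=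
  if_neg fun e => hc e.2

theorem cascadeProfile_of_lt {k : ℕ} {i : Fin n} {h : History n} (hk : h.length < k) :
    cascadeProfile n k i (observe i h) = 1 :=
  if_neg fun e => by
    have := e.1
    rw [length_observe] at this
    omega

theorem cascadeProfile_eq_zero {k : ℕ} {i : Fin n} {h : History n} (hk : k ≤ h.length)
    (hc : Conforms k (publicActs h)) (hf : AllFailures i h) :
    cascadeProfile n k i (observe i h) = 0 :=
  if_pos ⟨by simpa using hk, canStop_observe.mpr ⟨hc, hf⟩⟩

theorem cascadeProfile_of_not_conforms {k : ℕ} {h : History n}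
    (hc : ¬ Conforms k (publicActs h)) (i : Fin n) : cascadeProfile n k i (observe i h) = 1 :=
  cascadeProfile_eq_one fun e => hc (canStop_observe.mp e).1

theorem conforms_failureHistory (k t : ℕ) : Conforms k (publicActs (failureHistory n k t)) := by
  induction t with
  | zero => trivial
  | succ t ih =>
    refine conforms_cons.mpr ⟨fun j => ?_, ih⟩
    rw [length_failureHistory]
    split_ifs <;> rfl

theorem allFailures_failureHistory (k t : ℕ) (i : Fin n) :
    AllFailures i (failureHistory n k t) := by
  induction t with
  | zero => simp [AllFailures, failureHistory]
  | succ t ih =>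
    intro o ho
    rcases List.mem_cons.mp ho with rfl | ho
    · dsimp only
      split_ifs <;> simp
    · exact ih o ho

theorem allFailures_cons {i : Fin n} {o : Fin n → Outcome} {h : History n} :
    AllFailures i (o :: h) ↔ o i ≠ .high ∧ AllFailures i h := by
  simp [AllFailures]

theorem outcome_eq_of_act {y : Outcome} {c : Prop} [Decidable c] (hy : y ≠ .high)
    (ha : y.act = if c then Act.risky else Act.safe) :
    y = if c then Outcome.low else Outcome.safe := by
  cases y <;> split_ifs at * <;> simp_all [Outcome.act]

/-- Among the conforming histories, only one is without any success. -/
theorem eq_failureHistory {k : ℕ} {h : History n} (hc : Conforms k (publicActs h))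
    (hf : ∀ i, AllFailures i h) : h = failureHistory n k h.length := by
  induction h with
  | nil => rfl
  | cons o h ih =>
    have h1 := conforms_cons.mp hc
    have h2 := fun i => allFailures_cons.mp (hf i)
    rw [List.length_cons, failureHistory, ← ih h1.2 fun i => (h2 i).2]
    congr 1
    exact funext fun j => outcome_eq_of_act (h2 j).1 (h1.1 j)

/-- Conformity fixes all actions, and these fix the agent's own outcomes once successes are
excluded. So at each date there is exactly one information with `CanStop`, although its nodes differ
in what the others have privately drawn. -/
theorem observe_eq_failureHistory {k : ℕ} {i : Fin n} {h : History n}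
    (hc : CanStop k (observe i h)) : observe i h = observe i (failureHistory n k h.length) := by
  induction h with
  | nil => rfl
  | cons o h ih =>
    have h0 := canStop_observe.mp hc
    have h1 := conforms_cons.mp h0.1
    have h2 := allFailures_cons.mp h0.2
    rw [List.length_cons, failureHistory, observe_cons, observe_cons,
      ← ih (canStop_observe.mpr ⟨h1.2, h2.2⟩)]
    congr 1
    refine Prod.ext (funext fun j => (h1.1 j).trans ?_) (outcome_eq_of_act h2.1 (h1.1 i))
    dsimp only
    split_ifs <;> rfl

theorem canStop_of_observe_eq {k t : ℕ} {i : Fin n} {h : History n}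
    (e : observe i h = observe i (failureHistory n k t)) : CanStop k (observe i h) := by
  rw [e, canStop_observe]
  exact ⟨conforms_failureHistory k t, allFailures_failureHistory k t i⟩

theorem length_eq_of_observe {i : Fin n} {h h' : History n} (e : observe i h = observe i h') :
    h.length = h'.length := by
  rw [← length_observe i h, e, length_observe]

namespace Params

variable (M : Params)

theorem allFailures_of_isNode_bad {h : History n} (hn : M.IsNode .bad h) (i : Fin n) :
    AllFailures i h :=
  fun o ho => M.ne_high_of_chance_bad (hn o ho i)

theorem act_of_stepProb {σ : Profile n} {θ : State} {h : History n} {o : Fin n → Outcome}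
    {j : Fin n} (hj : σ j (observe j h) = 1) (ho : M.stepProb σ θ h o ≠ 0) :
    (o j).act = .risky := by
  have := M.outcomeProb_ne_zero_of_stepProb ho j
  rw [hj] at this
  exact M.act_of_outcomeProb_one this

theorem safe_of_stepProb {σ : Profile n} {θ : State} {h : History n} {o : Fin n → Outcome}
    {j : Fin n} (hj : σ j (observe j h) = 0) (ho : M.stepProb σ θ h o ≠ 0) :
    o j = .safe := by
  have := M.outcomeProb_ne_zero_of_stepProb ho j
  rw [hj] at this
  exact M.eq_safe_of_outcomeProb_zero this

/-! ### The path of play -/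

theorem conforms_of_reachProb_short {k : ℕ} {θ : State} {h : History n} (hk : h.length ≤ k)
    (hr : M.reachProb (cascadeProfile n k) θ h ≠ 0) : Conforms k (publicActs h) := by
  induction h with
  | nil => trivial
  | cons o h ih =>
    rw [reachProb] at hr
    rw [List.length_cons] at hk
    refine conforms_cons.mpr ⟨fun j => ?_, ih (by omega) (left_ne_zero_of_mul hr)⟩
    rw [if_pos (by omega)]
    exact M.act_of_stepProb (cascadeProfile_of_lt (by omega)) (right_ne_zero_of_mul hr)

/-- On the path of play, once everybody has stopped, nobody has had a success. -/
theorem allFailures_of_reachProb {k : ℕ} {θ : State} {h : History n} (hk : k < h.length)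
    (hc : Conforms k (publicActs h)) (hr : M.reachProb (cascadeProfile n k) θ h ≠ 0) (j : Fin n) :
    AllFailures j h := by
  cases h with
  | nil => simp at hk
  | cons o h =>
    have hk' : k ≤ h.length := by simpa [Nat.lt_succ_iff] using hk
    have h1 := conforms_cons.mp hc
    have h2 : (o j).act = .safe := by rw [h1.1 j, if_neg (by omega)]
    refine allFailures_cons.mpr ⟨fun e => by simp [e, Outcome.act] at h2, ?_⟩
    -- Somebody with a success would have played risky in the latest period, where conformity
    -- requires safe.
    by_contra hf
    have h3 := M.act_of_stepProb (j := j)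
      (cascadeProfile_eq_one fun e => hf (canStop_observe.mp e).2)
      (right_ne_zero_of_mul (a := M.reachProb (cascadeProfile n k) θ h) hr)
    rw [h2] at h3
    cases h3

/-- Without successes nobody ever has a reason to leave the pattern. Consequently a nonconforming
record that is reached with positive probability proves the good state. -/
theorem conforms_of_reachProb_bad {k : ℕ} {h : History n} (hn : M.IsNode .bad h)
    (hr : M.reachProb (cascadeProfile n k) .bad h ≠ 0) : Conforms k (publicActs h) := by
  induction h with
  | nil => trivial
  | cons o h ih =>
    rw [reachProb] at hr
    have hn' := (M.isNode_cons.mp hn).2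
    have hc := ih hn' (left_ne_zero_of_mul hr)
    refine conforms_cons.mpr ⟨fun j => ?_, hc⟩
    split_ifs with hk
    · exact M.act_of_stepProb (cascadeProfile_of_lt hk) (right_ne_zero_of_mul hr)
    · rw [M.safe_of_stepProb (j := j) (cascadeProfile_eq_zero (by omega) hc
        (M.allFailures_of_isNode_bad hn' j)) (right_ne_zero_of_mul hr)]
      rfl

theorem reachProb_bad_failureHistory (k t : ℕ) :
    M.reachProb (cascadeProfile n k) .bad (failureHistory n k t) = 1 := by
  induction t with
  | zero => rfl
  | succ t ih =>
    rw [failureHistory, reachProb, ih, one_mul, stepProb]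
    refine Finset.prod_eq_one fun j _ => ?_
    by_cases hk : t < k
    · rw [cascadeProfile_of_lt (by simpa using hk), if_pos hk]
      simp [outcomeProb, successProb]
    · rw [cascadeProfile_eq_zero (by simpa using hk) (conforms_failureHistory k t)
        (allFailures_failureHistory k t j), if_neg hk]
      simp [outcomeProb]

/-- Period `k + 1` reveals everything: an agent with a success would play risky then. If all play
safe, all have failed, and nobody moves afterwards. -/
theorem conforms_of_actAt {k : ℕ} {θ : State} {h : History n}
    (hr : M.reachProb (cascadeProfile n k) θ h ≠ 0) (hk : k < h.length)
    (ha : ∀ j, actAt j h (k + 1) = some Act.safe) : Conforms k (publicActs h) := by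
  induction h with
  | nil => simp at hk
  | cons o h ih =>
    rw [reachProb] at hr
    have hr1 := left_ne_zero_of_mul hr
    rw [List.length_cons] at hk
    rcases Nat.eq_or_lt_of_le (Nat.lt_succ_iff.mp hk) with e | hlt
    · refine conforms_cons.mpr ⟨fun j => ?_, M.conforms_of_reachProb_short e.ge hr1⟩
      have := ha j
      rw [actAt, if_pos (by omega)] at this
      rw [if_neg (by omega)]
      exact Option.some.inj this
    · have hc := ih hr1 hlt fun j => by
        have := ha j
        rwa [actAt, if_neg (by omega)] at this
      refine conforms_cons.mpr ⟨fun j => ?_, hc⟩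
      rw [if_neg (by omega), M.safe_of_stepProb (j := j) (cascadeProfile_eq_zero (by omega) hc
        (M.allFailures_of_reachProb hlt hc hr1 j)) (right_ne_zero_of_mul hr)]
      rfl

theorem actAt_of_conforms {k : ℕ} {h : History n} (hk : k < h.length)
    (hc : Conforms k (publicActs h)) (j : Fin n) : actAt j h (k + 1) = some Act.safe := by
  induction h with
  | nil => simp at hk
  | cons o h ih =>
    have h1 := conforms_cons.mp hc
    rw [List.length_cons] at hk
    rw [actAt]
    split_ifs with e
    · rw [h1.1 j, if_neg (by omega)]
    · exact ih (by omega) h1.2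

/-- With a common cutoff the conditions on earlier cutoffs are vacuous. The cutoff is `k + 1`
because a history of length `k` precedes period `k + 1`. -/
theorem inducesCascade_cascadeProfile (n k : ℕ) :
    M.InducesCascade (cascadeProfile n k) fun _ => k + 1 where
  one_le _ := by omega
  before h _ i hi := cascadeProfile_of_lt (by omega)
  switch := by
    rintro h ⟨θ, hr⟩ i hi _ hf
    exact cascadeProfile_eq_zero (by omega) (M.conforms_of_reachProb_short (by omega) hr.ne') hf
  noSwitch h _ i _ _ hf := cascadeProfile_eq_one fun e => hf (canStop_observe.mp e).2
  stay := by
    rintro h ⟨θ, hr⟩ i hi ha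
    have hc := M.conforms_of_actAt hr.ne' (by omega) fun j => ha j hi
    exact cascadeProfile_eq_zero (by omega) hc
      (M.allFailures_of_reachProb (by omega) hc hr.ne' i)
  cascade := by
    intro h _ j hj ha i
    refine cascadeProfile_of_not_conforms (fun hc => ?_) i
    rw [actAt_of_conforms (by omega) hc j] at ha
    simp at ha

end Params

end SocialBandit

/-! ### The solo problem as a bound on deviations -/

namespace SocialBandit

/-- Agent `i` sees only the actions of the others, so their outcomes may be replaced by any fixed
`c` with the same action. This provides one representative history for each continuation. -/
theorem observe_eq_of_others {n : ℕ} {i : Fin n} {o : Fin n → Outcome} {h h' : History n}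
    {c : Outcome} (ho : ∀ j, j ≠ i → (o j).act = c.act) (e : observe i h = observe i h') :
    observe i (o :: h) = observe i (Function.update (fun _ => c) i (o i) :: h') := by
  rw [observe_cons, observe_cons, e]
  congr 1
  refine Prod.ext (funext fun j => ?_) (by simp)
  by_cases hj : j = i
  · subst hj
    simp
  · simp [hj, ho j hj]

namespace Params

variable (M : Params) {n k : ℕ} {i : Fin n}

/-- Value of one risky action if a success is followed by playing risky forever and a failure by
stopping. -/
def exploreValue (θ : State) : ℝ :=
  (1 - M.δ) * M.mean θ + M.δ * M.successProb θ * M.E1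

/-- Value of exploring alone until the first success, but at most `N` times. -/
def soloValue (θ : State) : ℕ → ℝ
  | 0 => 0
  | N + 1 => M.exploreValue θ + M.δ * (1 - M.successProb θ) * soloValue θ N

theorem exploreValue_good : M.exploreValue .good = (1 - M.δ) * M.E1 + M.δ * M.π * M.E1 := rfl

theorem exploreValue_bad : M.exploreValue .bad = -((1 - M.δ) * M.E0) := by
  simp [exploreValue, mean_bad, successProb]

theorem exploreValue_good_pos : 0 < M.exploreValue .good := by
  have h1 := M.E1_pos
  have h2 := M.δ_pos
  have h3 : 0 < 1 - M.δ := by linarith [M.δ_lt_one]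
  have h4 := M.π_pos
  rw [exploreValue_good]
  positivity

theorem value_le_E1 (σ : Profile n) (i : Fin n) (θ : State) (h : History n) :
    M.value σ i θ h ≤ M.E1 := by
  cases θ
  · exact M.value_good_le σ i h
  · exact (M.value_bad_nonpos σ i h).trans M.E1_pos.le

/-- After a success the crude bound `E1` is enough, since risky play forever attains it. Only the
continuations after a failure and after safe play need an estimate. -/
theorem value_update_le {σ : Profile n} {s : Info n → unitInterval} {θ : State} {h : History n}
    {l f : ℝ}
    (hl : ∀ o, M.stepProb (Function.update σ i fun _ => 1) θ h o ≠ 0 → o i = .low →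
      M.value (Function.update σ i s) i θ (o :: h) ≤ l)
    (hf : ∀ o, M.stepProb (Function.update σ i fun _ => 0) θ h o ≠ 0 → o i = .safe →
      M.value (Function.update σ i s) i θ (o :: h) ≤ f) :
    M.value (Function.update σ i s) i θ h ≤ s (observe i h) *
      (M.exploreValue θ + M.δ * ((1 - M.successProb θ) * l))
      + (1 - s (observe i h)) * (M.δ * f) := by
  have hδ := M.δ_pos.le
  rw [value_update]
  refine add_le_add (mul_le_mul_of_nonneg_left ?_ (s _).2.1)
    (mul_le_mul_of_nonneg_left ?_ (sub_nonneg.mpr (s _).2.2))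
  · let g : Outcome → ℝ := fun y => (1 - M.δ) * M.payoff y +
      M.δ * (match y with | .safe => 0 | .high => M.E1 | .low => l)
    refine (M.expect_mono _ θ h (g := fun o => g (o i)) fun o ho => ?_).trans_eq ?_
    · have h1 := M.act_of_stepProb (j := i) (by simp) ho
      refine add_le_add le_rfl (mul_le_mul_of_nonneg_left ?_ hδ)
      cases hy : o i with
      | safe => simp [hy, Outcome.act] at h1
      | high => exact M.value_le_E1 _ _ _ _
      | low => exact hl o ho hy
    · rw [M.expect_risky _ θ h i (by simp)]
      simp only [g, payoff, exploreValue, mean]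
      ring
  · refine (M.expect_mono _ θ h (g := fun _ => M.δ * f) fun o ho => ?_).trans_eq
      (M.expect_const _ θ h _)
    have h1 := M.safe_of_stepProb (j := i) (by simp) ho
    have h2 := mul_le_mul_of_nonneg_left (hf o ho h1) hδ
    simpa [h1, payoff] using h2

/-! ### Nonconforming public histories: a deviator learns only from her own outcomes -/

/-- Nonconformity is public and permanent, and it makes the others play risky whatever they have
drawn. Their private outcomes therefore influence neither their later actions nor the deviator's
payoff. -/
theorem value_congr_of_not_conforms {s : Info n → unitInterval} {h h' : History n}
    (hc : ¬ Conforms k (publicActs h)) (e : observe i h = observe i h') (θ : State) :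
    M.value (Function.update (cascadeProfile n k) i s) i θ h
      = M.value (Function.update (cascadeProfile n k) i s) i θ h' := by
  have key : ∀ (m : ℕ) (h h' : History n), ¬ Conforms k (publicActs h) →
      observe i h = observe i h' →
      M.stageValue (Function.update (cascadeProfile n k) i s) i θ m h
        = M.stageValue (Function.update (cascadeProfile n k) i s) i θ m h' := by
    intro m
    induction m with
    | zero =>
      intro h h' _ e
      rw [stageValue, stageValue, expect_payoff, expect_payoff, e]
    | succ m ih =>
      intro h h' hc e
      rw [stageValue, stageValue]
      refine Finset.sum_congr rfl fun o _ => ?_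
      congr 1
      · refine M.stepProb_congr (fun j => ?_) θ o
        by_cases hj : j = i
        · subst hj
          simp [e]
        · rw [Function.update_of_ne hj, cascadeProfile_of_not_conforms hc,
            cascadeProfile_of_not_conforms (publicActs_of_observe e ▸ hc)]
      · exact ih _ _ (not_conforms_cons hc o) (by rw [observe_cons, observe_cons, e])
  simp only [value, fun m => key m h h' hc e]

theorem act_of_stepProb_update {a : Info n → unitInterval} {σ : Profile n} {θ : State}
    {h : History n} {o : Fin n → Outcome} {j : Fin n} (hj : j ≠ i)
    (h1 : σ j (observe j h) = 1) (ho : M.stepProb (Function.update σ i a) θ h o ≠ 0) :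
    (o j).act = .risky :=
  M.act_of_stepProb (j := j) (by rwa [Function.update_of_ne hj]) ho

theorem safe_of_stepProb_update {a : Info n → unitInterval} {σ : Profile n} {θ : State}
    {h : History n} {o : Fin n → Outcome} {j : Fin n} (hj : j ≠ i)
    (h0 : σ j (observe j h) = 0) (ho : M.stepProb (Function.update σ i a) θ h o ≠ 0) :
    o j = .safe :=
  M.safe_of_stepProb (j := j) (by rwa [Function.update_of_ne hj]) ho

theorem value_update_le_of_not_conforms (s : Info n → unitInterval) (θ : State) {h : History n}
    (hc : ¬ Conforms k (publicActs h)) :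
    M.value (Function.update (cascadeProfile n k) i s) i θ h ≤ s (observe i h) *
      (M.exploreValue θ + M.δ * ((1 - M.successProb θ) *
        M.value (Function.update (cascadeProfile n k) i s) i θ
          (Function.update (fun _ => Outcome.low) i .low :: h)))
      + (1 - s (observe i h)) * (M.δ *
        M.value (Function.update (cascadeProfile n k) i s) i θ
          (Function.update (fun _ => Outcome.low) i .safe :: h)) := by
  have key : ∀ (a : Info n → unitInterval) (o : Fin n → Outcome),
      M.stepProb (Function.update (cascadeProfile n k) i a) θ h o ≠ 0 →
      M.value (Function.update (cascadeProfile n k) i s) i θ (o :: h)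
        = M.value (Function.update (cascadeProfile n k) i s) i θ
          (Function.update (fun _ => Outcome.low) i (o i) :: h) := by
    intro a o ho
    exact M.value_congr_of_not_conforms (not_conforms_cons hc o) (observe_eq_of_others (c := .low)
      (fun j hj => M.act_of_stepProb_update hj (cascadeProfile_of_not_conforms hc j) ho) rfl) θ
  refine M.value_update_le (fun o ho hy => ?_) fun o ho hy => ?_ <;>
  exact (hy ▸ key _ o ho).le

/-- `G` and `B` are unnormalized posterior weights of the good and the bad state. A failure
multiplies `G` by `1 - π` and leaves `B` unchanged, so the value is a discounted sum of the terms in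
`hpos`. -/
theorem soloValue_nonneg {G B : ℝ} {N : ℕ}
    (hpos : ∀ l < N, 0 ≤ G * (1 - M.π) ^ l * M.exploreValue .good + B * M.exploreValue .bad) :
    0 ≤ G * M.soloValue .good N + B * M.soloValue .bad N := by
  induction N generalizing G with
  | zero => simp [soloValue]
  | succ N ih =>
    have h0 := hpos 0 (by omega)
    have h1 := ih (G := G * (1 - M.π)) fun l hl => by
      have := hpos (l + 1) (by omega)
      rwa [pow_succ', ← mul_assoc] at this
    have h2 := mul_nonneg M.δ_pos.le h1
    simp only [soloValue, successProb] at *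
    linarith

/-- One step of an approximate dynamic programming argument: if `W` dominates both actions up to a
continuation error `e`, it dominates their mixture up to `δ * e`. Delay is harmless because `0 ≤ W`.
-/
theorem mix_le {x c L W e low safe δ : ℝ} (hx0 : 0 ≤ x) (hx1 : x ≤ 1) (hδ0 : 0 ≤ δ) (hδ1 : δ ≤ 1)
    (hW : 0 ≤ W) (hL : c + δ * L ≤ W) (hlow : low ≤ L + e) (hsafe : safe ≤ W + e) :
    x * (c + δ * low) + (1 - x) * (δ * safe) ≤ W + δ * e := by
  have h1 : c + δ * low ≤ W + δ * e := by
    have := mul_le_mul_of_nonneg_left hlow hδ0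
    linarith
  have h2 : δ * safe ≤ W + δ * e := by
    have := mul_le_mul_of_nonneg_left hsafe hδ0
    nlinarith
  nlinarith

theorem le_of_le_add_pow {a b c : ℝ} (H : ∀ T : ℕ, a ≤ b + M.δ ^ T * c) : a ≤ b := by
  have h1 := ((tendsto_pow_atTop_nhds_zero_of_lt_one M.δ_pos.le M.δ_lt_one).mul_const c).const_add b
  rw [zero_mul, add_zero] at h1
  exact ge_of_tendsto' h1 H

/-- A deviator who learns only from her own outcomes does not get more than the value of the
solo problem. -/
theorem value_le_soloValue (s : Info n → unitInterval) {G B : ℝ} {N : ℕ} {h : History n}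
    (hG : 0 ≤ G) (hB : 0 ≤ B)
    (hpos : ∀ l < N, 0 ≤ G * (1 - M.π) ^ l * M.exploreValue .good + B * M.exploreValue .bad)
    (hneg : G * (1 - M.π) ^ N * M.exploreValue .good + B * M.exploreValue .bad ≤ 0)
    (hc : ¬ Conforms k (publicActs h)) :
    G * M.value (Function.update (cascadeProfile n k) i s) i .good h
      + B * M.value (Function.update (cascadeProfile n k) i s) i .bad h
      ≤ G * M.soloValue .good N + B * M.soloValue .bad N := by
  -- The crude bound `E1` is used after `T` periods; its contribution vanishes by discounting as `T`
  -- grows.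
  refine M.le_of_le_add_pow (c := G * M.E1) fun T => ?_
  induction T generalizing N G h with
  | zero =>
    have h1 := M.soloValue_nonneg hpos
    have h2 := mul_le_mul_of_nonneg_left
      (M.value_good_le (Function.update (cascadeProfile n k) i s) i h) hG
    have h3 := mul_nonpos_of_nonneg_of_nonpos hB
      (M.value_bad_nonpos (Function.update (cascadeProfile n k) i s) i h)
    rw [pow_zero, one_mul]
    linarith
  | succ T ih =>
    have hπ : 0 ≤ 1 - M.π := by linarith [M.π_lt_one]
    have hπ1 : 1 - M.π ≤ 1 := by linarith [M.π_pos]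
    have hg := mul_le_mul_of_nonneg_left
      (M.value_update_le_of_not_conforms (i := i) s .good hc) hG
    have hb := mul_le_mul_of_nonneg_left
      (M.value_update_le_of_not_conforms (i := i) s .bad hc) hB
    have hsafe := ih hG hpos hneg
      (not_conforms_cons hc (Function.update (fun _ => Outcome.low) i .safe))
    have hE : M.δ ^ T * (G * (1 - M.π) * M.E1) ≤ M.δ ^ T * (G * M.E1) := by
      refine mul_le_mul_of_nonneg_left ?_ (pow_nonneg M.δ_pos.le T)
      exact mul_le_mul_of_nonneg_right (mul_le_of_le_one_right hG hπ1) M.E1_pos.le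
    -- `L` is the solo value after one more failure: one exploration fewer remains, or none if
    -- already `N = 0`.
    obtain ⟨L, hL, hlow⟩ : ∃ L, G * M.exploreValue .good + B * M.exploreValue .bad + M.δ * L
          ≤ G * M.soloValue .good N + B * M.soloValue .bad N ∧
        G * (1 - M.π) * M.value (Function.update (cascadeProfile n k) i s) i .good
          (Function.update (fun _ => Outcome.low) i .low :: h)
        + B * M.value (Function.update (cascadeProfile n k) i s) i .bad
          (Function.update (fun _ => Outcome.low) i .low :: h) ≤ L + M.δ ^ T * (G * M.E1) := by
      cases N with
      | zero =>
        refine ⟨0, by simpa [soloValue] using hneg, ?_⟩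
        have h1 : G * (1 - M.π) * M.exploreValue .good ≤ G * M.exploreValue .good :=
          mul_le_mul_of_nonneg_right (mul_le_of_le_one_right hG hπ1) M.exploreValue_good_pos.le
        have h2 := ih (N := 0) (mul_nonneg hG hπ) (by simp)
          (by rw [pow_zero, mul_one] at *; linarith)
          (not_conforms_cons hc (Function.update (fun _ => Outcome.low) i .low))
        simp only [soloValue, mul_zero, add_zero, zero_add] at *
        exact h2.trans hE
      | succ N =>
        refine ⟨_, le_of_eq ?_, (ih (N := N) (mul_nonneg hG hπ) (fun l hl => ?_) ?_
          (not_conforms_cons hc (Function.update (fun _ => Outcome.low) i .low))).trans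
            (add_le_add le_rfl hE)⟩
        · simp only [soloValue, successProb]
          ring
        · have := hpos (l + 1) (by omega)
          rwa [pow_succ', ← mul_assoc] at this
        · rwa [pow_succ', ← mul_assoc] at hneg
    have hx := (s (observe i h)).2
    have key := mix_le hx.1 hx.2 M.δ_pos.le M.δ_lt_one.le (M.soloValue_nonneg hpos) hL hlow hsafe
    refine (add_le_add hg hb).trans (le_trans (le_of_eq ?_) (key.trans_eq ?_))
    · simp only [successProb]
      ring
    · ring

/-! ### After everybody has stopped -/

theorem not_conforms_of_risky {h : History n} (hk : k ≤ h.length) {o : Fin n → Outcome}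
    {j : Fin n} (hj : (o j).act = .risky) : ¬ Conforms k (publicActs (o :: h)) := by
  intro hc
  have := (conforms_cons.mp hc).1 j
  rw [hj, if_neg (by omega)] at this
  cases this

theorem value_update_le_of_stopped (s : Info n → unitInterval) (θ : State) {t : ℕ} (ht : k ≤ t) :
    M.value (Function.update (cascadeProfile n k) i s) i θ (failureHistory n k t) ≤
      s (observe i (failureHistory n k t)) *
        (M.exploreValue θ + M.δ * ((1 - M.successProb θ) *
          M.value (Function.update (cascadeProfile n k) i s) i θ
            (Function.update (fun _ => Outcome.safe) i .low :: failureHistory n k t)))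
      + (1 - s (observe i (failureHistory n k t))) * (M.δ *
        M.value (Function.update (cascadeProfile n k) i s) i θ (failureHistory n k (t + 1))) := by
  have others : ∀ (a : Info n → unitInterval) (o : Fin n → Outcome),
      M.stepProb (Function.update (cascadeProfile n k) i a) θ (failureHistory n k t) o ≠ 0 →
      ∀ j, j ≠ i → o j = .safe := fun a o ho j hj =>
    M.safe_of_stepProb_update hj (cascadeProfile_eq_zero (by simpa using ht)
      (conforms_failureHistory k t) (allFailures_failureHistory k t j)) ho
  refine M.value_update_le (fun o ho hy => le_of_eq ?_) fun o ho hy => le_of_eq ?_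
  · rw [← hy]
    refine M.value_congr_of_not_conforms
      (not_conforms_of_risky (j := i) (by simpa using ht) (by rw [hy]; rfl))
      (observe_eq_of_others (fun j hj => by rw [others _ o ho j hj]) rfl) θ
  · have : o = fun _ => if t < k then Outcome.low else Outcome.safe := by
      funext j
      rw [if_neg (by omega)]
      by_cases hj : j = i
      · rwa [hj]
      · exact others _ o ho j hj
    rw [this, failureHistory]

/-- When all others have stopped, waiting teaches nothing, and a risky action starts a solo problem
in which no exploration pays. -/
theorem value_nonpos_of_stopped (s : Info n → unitInterval) {G B : ℝ} {t : ℕ} (ht : k ≤ t)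
    (hG : 0 ≤ G) (hB : 0 ≤ B) (hneg : G * M.exploreValue .good + B * M.exploreValue .bad ≤ 0) :
    G * M.value (Function.update (cascadeProfile n k) i s) i .good (failureHistory n k t)
      + B * M.value (Function.update (cascadeProfile n k) i s) i .bad (failureHistory n k t)
      ≤ 0 := by
  refine M.le_of_le_add_pow (c := G * M.E1) fun T => ?_
  induction T generalizing t with
  | zero =>
    have h2 := mul_le_mul_of_nonneg_left
      (M.value_good_le (Function.update (cascadeProfile n k) i s) i (failureHistory n k t)) hG
    have h3 := mul_nonpos_of_nonneg_of_nonpos hB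
      (M.value_bad_nonpos (Function.update (cascadeProfile n k) i s) i (failureHistory n k t))
    rw [pow_zero, one_mul]
    linarith
  | succ T ih =>
    have hπ : 0 ≤ 1 - M.π := by linarith [M.π_lt_one]
    have hπ1 : 1 - M.π ≤ 1 := by linarith [M.π_pos]
    have hg := mul_le_mul_of_nonneg_left (M.value_update_le_of_stopped (i := i) s .good ht) hG
    have hb := mul_le_mul_of_nonneg_left (M.value_update_le_of_stopped (i := i) s .bad ht) hB
    have hsafe := ih (t := t + 1) (by omega)
    have h1 : G * (1 - M.π) * M.exploreValue .good ≤ G * M.exploreValue .good :=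
      mul_le_mul_of_nonneg_right (mul_le_of_le_one_right hG hπ1) M.exploreValue_good_pos.le
    have hlow := M.value_le_soloValue (i := i) s (N := 0) (mul_nonneg hG hπ) hB (by simp)
      (by rw [pow_zero, mul_one]; linarith)
      (not_conforms_of_risky (k := k) (h := failureHistory n k t) (by simpa using ht)
        (o := Function.update (fun _ => Outcome.safe) i .low) (j := i) (by simp [Outcome.act]))
    simp only [soloValue, mul_zero, add_zero] at hlow
    have hE : 0 ≤ M.δ ^ T * (G * M.E1) :=
      mul_nonneg (pow_nonneg M.δ_pos.le T) (mul_nonneg hG M.E1_pos.le)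
    have hx := (s (observe i (failureHistory n k t))).2
    have key := mix_le (c := G * M.exploreValue .good + B * M.exploreValue .bad) (L := 0) hx.1 hx.2
      M.δ_pos.le M.δ_lt_one.le le_rfl (by rw [mul_zero, add_zero]; exact hneg) (hlow.trans (by rw [zero_add]; exact hE)) hsafe
    refine (add_le_add hg hb).trans (le_trans (le_of_eq ?_) (key.trans_eq ?_))
    · simp only [successProb]
      ring
    · ring

/-! ### Values of the cascade profile -/

theorem value_cascade_of_not_canStop {h : History n} (hc : ¬ CanStop k (observe i h)) :
    M.value (cascadeProfile n k) i .good h = M.E1 := by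
  refine M.value_eq_of_stageValue fun s => ?_
  induction s generalizing h with
  | zero => rw [stageValue, expect_payoff, cascadeProfile_eq_one hc]; simp [mean_good]
  | succ s ih =>
    rw [stageValue]
    simp_rw [fun o => ih (not_canStop_cons hc o)]
    exact M.expect_const _ _ _ _

theorem value_cascade_stopped (θ : State) {t : ℕ} (ht : k ≤ t) :
    M.value (cascadeProfile n k) i θ (failureHistory n k t) = 0 := by
  refine M.value_eq_of_stageValue fun s => ?_
  have hz : ∀ {t}, k ≤ t → ∀ j, cascadeProfile n k j (observe j (failureHistory n k t)) = 0 :=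
    fun ht j => cascadeProfile_eq_zero (by simpa using ht) (conforms_failureHistory k _)
      (allFailures_failureHistory k _ j)
  induction s generalizing t with
  | zero => rw [stageValue, expect_payoff, hz ht]; simp
  | succ s ih =>
    rw [stageValue]
    refine Finset.sum_eq_zero fun o _ => ?_
    by_cases ho : M.stepProb (cascadeProfile n k) θ (failureHistory n k t) o = 0
    · rw [ho, zero_mul]
    · have : o = fun _ => if t < k then Outcome.low else Outcome.safe := by
        funext j
        rw [if_neg (by omega)]
        exact M.safe_of_stepProb (hz ht j) ho
      have h1 := ih (t := t + 1) (by omega)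
      rw [failureHistory] at h1
      rw [this, h1, mul_zero]

theorem conforms_cons_of_stepProb {θ : State} {h : History n} {o : Fin n → Outcome}
    (hk : h.length < k) (hc : Conforms k (publicActs h))
    (ho : M.stepProb (cascadeProfile n k) θ h o ≠ 0) : Conforms k (publicActs (o :: h)) :=
  conforms_cons.mpr
    ⟨fun j => by rw [if_pos hk]; exact M.act_of_stepProb (cascadeProfile_of_lt hk) ho, hc⟩

/-- Up to the cutoff the agent does exactly what the solo plan does. The inequality may be strict
since another agent's success can make her resume risky play in the good state. -/
theorem soloValue_le_value {θ : State} {N : ℕ} {h : History n} (hN : h.length + N = k)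
    (hn : M.IsNode θ h) (hc : CanStop k (observe i h)) :
    M.soloValue θ N ≤ M.value (cascadeProfile n k) i θ h := by
  induction N generalizing h with
  | zero =>
    rw [soloValue]
    cases θ with
    | good => exact M.value_good_nonneg _ _ _
    | bad =>
      rw [eq_failureHistory (canStop_observe.mp hc).1 (M.allFailures_of_isNode_bad hn)]
      exact (M.value_cascade_stopped _ (by omega)).ge
  | succ N ih =>
    have hk : h.length < k := by omega
    let g : Outcome → ℝ := fun y => (1 - M.δ) * M.payoff y +
      M.δ * (match y with | .safe => 0 | .high => M.E1 | .low => M.soloValue θ N)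
    rw [value_eq]
    refine Eq.trans_le ?_ (M.expect_mono _ θ h (f := fun o => g (o i)) fun o ho => ?_)
    · rw [M.expect_risky _ θ h i (cascadeProfile_of_lt hk)]
      simp only [g, payoff, soloValue, exploreValue, mean]
      ring
    · have h1 := M.act_of_stepProb (cascadeProfile_of_lt hk (i := i)) ho
      have hn' := M.isNode_cons_of_stepProb hn ho
      refine add_le_add le_rfl (mul_le_mul_of_nonneg_left ?_ M.δ_pos.le)
      cases hy : o i with
      | safe => simp [hy, Outcome.act] at h1
      | high =>
        have hs : ¬ AllFailures i (o :: h) := fun e => (allFailures_cons.mp e).1 hy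
        cases θ with
        | good => exact (M.value_cascade_of_not_canStop fun e => hs (canStop_observe.mp e).2).ge
        | bad => exact absurd (M.allFailures_of_isNode_bad hn' i) hs
      | low =>
        have h2 := canStop_observe.mp hc
        exact ih (by rw [List.length_cons]; omega) hn' (canStop_observe.mpr
          ⟨M.conforms_cons_of_stepProb hk h2.1 ho, allFailures_cons.mpr ⟨by simp [hy], h2.2⟩⟩)

end Params

end SocialBandit

namespace SocialBandit

namespace Params

variable (M : Params) {n k : ℕ} {i : Fin n}

/-! ### Deviations on the path of play -/

/-- Even an agent who learns the state next period loses today's payoff if she plays safe. This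
controls deviations at the cutoff when another agent has had a success. -/
theorem value_le_of_action (σ : Profile n) (i : Fin n) (h : History n) :
    M.value σ i .good h ≤ (1 - M.δ) * (σ i (observe i h) * M.E1) + M.δ * M.E1 := by
  have h1 : ∑ o, M.stepProb σ .good h o *
      ((1 - M.δ) * M.payoff (o i) + M.δ * M.E1)
      = (1 - M.δ) * (σ i (observe i h) * M.E1) + M.δ * M.E1 := by
    simp_rw [mul_add, Finset.sum_add_distrib]
    rw [M.expect_const, ← M.mean_good, ← M.expect_payoff σ .good h i, Finset.mul_sum]
    congr 1
    exact Finset.sum_congr rfl fun o _ => by ring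
  rw [value_eq, ← h1]
  exact M.expect_mono _ _ _ fun o _ =>
    add_le_add le_rfl (mul_le_mul_of_nonneg_left (M.value_good_le _ _ _) M.δ_pos.le)

/-- At her cutoff, an agent learns for free if somebody else has had a success. -/
theorem value_cascade_of_other_success {h : History n} (hk : h.length = k)
    (hc : CanStop k (observe i h)) {j : Fin n} (hj : ¬ AllFailures j h) :
    M.value (cascadeProfile n k) i .good h = M.δ * M.E1 := by
  have h2 := canStop_observe.mp hc
  rw [value_eq, ← M.expect_const (cascadeProfile n k) .good h (M.δ * M.E1)]
  refine Finset.sum_congr rfl fun o _ => ?_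
  by_cases ho : M.stepProb (cascadeProfile n k) .good h o = 0
  · rw [ho, zero_mul, zero_mul]
  · have hi := M.safe_of_stepProb (j := i) (cascadeProfile_eq_zero hk.ge h2.1 h2.2) ho
    have hr := M.act_of_stepProb (j := j)
      (cascadeProfile_eq_one fun e => hj (canStop_observe.mp e).2) ho
    rw [hi, M.value_cascade_of_not_canStop fun e =>
      not_conforms_of_risky hk.ge hr (canStop_observe.mp e).1]
    simp [payoff]

/-- Before and at the cutoff, a deviation gains at most as much as in the solo problem, where it
does not gain at all. -/
theorem exists_deviation_bound (s : Info n → unitInterval) {G B : ℝ} (hG : 0 ≤ G) (hB : 0 ≤ B)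
    (hpos : ∀ l < k, 0 ≤ G * (1 - M.π) ^ l * M.exploreValue .good + B * M.exploreValue .bad)
    (hneg : G * (1 - M.π) ^ k * M.exploreValue .good + B * M.exploreValue .bad ≤ 0)
    {N t : ℕ} (ht : t + N = k) :
    ∃ S : State → ℝ, (∀ θ h, M.IsNode θ h → observe i h = observe i (failureHistory n k t) →
        M.value (Function.update (cascadeProfile n k) i s) i θ h
          - M.value (cascadeProfile n k) i θ h ≤ S θ) ∧
      G * (1 - M.π) ^ t * S .good + B * S .bad ≤ 0 := by
  have hπ : 0 ≤ 1 - M.π := by linarith [M.π_lt_one]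
  have hδ := M.δ_pos.le
  induction N generalizing t with
  | zero =>
    obtain rfl : t = k := by omega
    set V := fun θ h => M.value (Function.update (cascadeProfile n t) i s) i θ h with hV
    set x := s (observe i (failureHistory n t t)) with hx
    set d := Function.update (fun _ => Outcome.safe) i .low :: failureHistory n t t with hd
    have hS : ∀ θ, V θ (failureHistory n t t) ≤ x * (M.exploreValue θ + M.δ *
        ((1 - M.successProb θ) * V θ d)) + (1 - x) * (M.δ * V θ (failureHistory n t (t + 1))) :=
      fun θ => M.value_update_le_of_stopped s θ le_rfl
    -- The witness is the one-step bound at the node where everybody has failed; there the profile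
    -- itself yields 0.
    refine ⟨fun θ => x * (M.exploreValue θ + M.δ * ((1 - M.successProb θ) * V θ d))
      + (1 - x) * (M.δ * V θ (failureHistory n t (t + 1))), fun θ h hn e => ?_, ?_⟩
    · have hl : h.length = t := by simpa using length_eq_of_observe e
      have hc := canStop_of_observe_eq e
      by_cases hf : ∀ j, AllFailures j h
      · have h1 := eq_failureHistory (canStop_observe.mp hc).1 hf
        rw [hl] at h1
        rw [h1, M.value_cascade_stopped θ le_rfl, sub_zero]
        exact hS θ
      · push Not at hf
        obtain ⟨j, hj⟩ := hf
        cases θ with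
        | bad => exact absurd (M.allFailures_of_isNode_bad hn j) hj
        | good =>
          -- If another agent has had a success, the profile yields `δ * E1`, so the gain is at most
          -- `(1 - δ) * x * E1`. The witness contains this term, and its other terms are nonnegative
          -- in the good state.
          have h1 := M.value_le_of_action (Function.update (cascadeProfile n t) i s) i h
          rw [Function.update_self, e, ← hx] at h1
          rw [M.value_cascade_of_other_success hl hc hj]
          have h2 : 0 ≤ V .good d := M.value_good_nonneg _ _ _
          have h3 : 0 ≤ V .good (failureHistory n t (t + 1)) := M.value_good_nonneg _ _ _
          have hx0 := x.2.1
          have hx1 : 0 ≤ 1 - (x : ℝ) := sub_nonneg.mpr x.2.2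
          have h4 : 0 ≤ (x : ℝ) * (M.δ * M.π * M.E1 + M.δ * ((1 - M.π) * V .good d)) := by
            have := M.E1_pos
            have := M.π_pos
            positivity
          have h5 : 0 ≤ (1 - (x : ℝ)) * (M.δ * V .good (failureHistory n t (t + 1))) := by
            positivity
          simp only [exploreValue_good, successProb]
          linarith
    · have h1 : G * (1 - M.π) ^ t * (1 - M.π) * M.exploreValue .good
          ≤ G * (1 - M.π) ^ t * M.exploreValue .good :=
        mul_le_mul_of_nonneg_right (mul_le_of_le_one_right (mul_nonneg hG (pow_nonneg hπ t))
          (by linarith [M.π_pos])) M.exploreValue_good_pos.le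
      have hlow := M.value_le_soloValue (i := i) s (N := 0)
        (mul_nonneg (mul_nonneg hG (pow_nonneg hπ t)) hπ) hB (by simp)
        (by rw [pow_zero, mul_one]; linarith)
        (not_conforms_of_risky (k := t) (h := failureHistory n t t) (by simp)
          (o := Function.update (fun _ => Outcome.safe) i .low) (j := i) (by simp [Outcome.act]))
      have hsafe := M.value_nonpos_of_stopped (n := n) (i := i) s (Nat.le_succ t)
        (mul_nonneg hG (pow_nonneg hπ t)) hB hneg
      simp only [soloValue, mul_zero, add_zero] at hlow
      have key := mix_le (c := G * (1 - M.π) ^ t * M.exploreValue .good + B * M.exploreValue .bad)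
        (L := 0) (W := 0) (e := 0) x.2.1 x.2.2 hδ M.δ_lt_one.le le_rfl
        (by rw [mul_zero, add_zero]; exact hneg) (hlow.trans_eq (add_zero 0).symm)
        (hsafe.trans_eq (add_zero 0).symm)
      refine le_trans (le_of_eq ?_) (key.trans_eq (by simp))
      simp only [successProb, hV, hd]
      ring
  | succ N ih =>
    obtain ⟨S, hS, hS0⟩ := ih (t := t + 1) (by omega)
    have htk : t < k := by omega
    set V := fun θ h => M.value (Function.update (cascadeProfile n k) i s) i θ h with hV
    set x := s (observe i (failureHistory n k t)) with hx
    set d := Function.update (fun _ => Outcome.low) i .safe :: failureHistory n k t with hd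
    have hdc : ¬ Conforms k (publicActs d) := fun hc => by
      have := (conforms_cons.mp hc).1 i
      simp [Outcome.act, htk] at this
    -- Playing risky follows the profile and only postpones the gain to the next failure. Playing
    -- safe is detected, leads to `d`, and forgoes at least the solo value.
    refine ⟨fun θ => x * (M.δ * ((1 - M.successProb θ) * S θ))
      + (1 - x) * (M.δ * V θ d - M.soloValue θ (N + 1)), fun θ h hn e => ?_, ?_⟩
    · have hl : h.length = t := by simpa using length_eq_of_observe e
      have hc := canStop_of_observe_eq e
      have hc' := canStop_observe.mp hc
      have hlk : h.length < k := by omega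
      have hlow := M.soloValue_le_value (N := N + 1) (by omega) hn hc
      have hone : ∀ o, M.stepProb (Function.update (cascadeProfile n k) i fun _ => 1) θ h o
          = M.stepProb (cascadeProfile n k) θ h o := by
        refine M.stepProb_congr (fun j => ?_) θ
        by_cases hj : j = i
        · subst hj
          rw [Function.update_self, cascadeProfile_of_lt hlk]
        · rw [Function.update_of_ne hj]
      have hr : ∑ o, M.stepProb (Function.update (cascadeProfile n k) i fun _ => 1) θ h o *
          ((1 - M.δ) * M.payoff (o i) + M.δ * V θ (o :: h))
          ≤ M.value (cascadeProfile n k) i θ h + M.δ * ((1 - M.successProb θ) * S θ) := by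
        simp_rw [hone]
        let g : Outcome → ℝ := fun y => M.δ * (match y with | .safe => 0 | .high => 0 | .low => S θ)
        have h1 : ∑ o, M.stepProb (cascadeProfile n k) θ h o * g (o i)
            = M.δ * ((1 - M.successProb θ) * S θ) := by
          rw [M.expect_risky _ θ h i (cascadeProfile_of_lt hlk)]
          simp only [g]
          ring
        rw [← h1, value_eq _ (cascadeProfile n k), ← Finset.sum_add_distrib]
        simp_rw [← mul_add]
        refine M.expect_mono _ θ h fun o ho => ?_
        rw [add_assoc]
        refine add_le_add le_rfl ?_
        rw [← mul_add]
        refine mul_le_mul_of_nonneg_left ?_ hδ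
        have h2 := M.act_of_stepProb (cascadeProfile_of_lt hlk (i := i)) ho
        have hn' := M.isNode_cons_of_stepProb hn ho
        cases hy : o i with
        | safe => simp [hy, Outcome.act] at h2
        | high =>
          have hs : ¬ AllFailures i (o :: h) := fun e => (allFailures_cons.mp e).1 hy
          cases θ with
          | good =>
            rw [M.value_cascade_of_not_canStop fun e => hs (canStop_observe.mp e).2]
            simpa using M.value_good_le _ _ _
          | bad => exact absurd (M.allFailures_of_isNode_bad hn' i) hs
        | low =>
          have h3 : observe i (o :: h) = observe i (failureHistory n k (t + 1)) := by
            have h4 : CanStop k (observe i (o :: h)) := canStop_observe.mpr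
              ⟨M.conforms_cons_of_stepProb hlk hc'.1 ho,
                allFailures_cons.mpr ⟨by simp [hy], hc'.2⟩⟩
            rw [observe_eq_failureHistory h4, List.length_cons, hl]
          have := hS θ _ hn' h3
          simp only [hV]
          linarith
      have hs : ∑ o, M.stepProb (Function.update (cascadeProfile n k) i fun _ => 0) θ h o *
          ((1 - M.δ) * M.payoff (o i) + M.δ * V θ (o :: h)) ≤ M.δ * V θ d := by
        refine (M.expect_mono _ θ h (g := fun _ => M.δ * V θ d) fun o ho => le_of_eq ?_).trans_eq
          (M.expect_const _ θ h _)
        have h1 := M.safe_of_stepProb (j := i) (by simp) ho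
        have h2 : observe i (o :: h) = observe i d := by
          rw [hd, ← h1]
          exact observe_eq_of_others (c := .low) (fun j hj =>
            M.act_of_stepProb_update hj (cascadeProfile_of_lt hlk) ho) e
        have h3 : V θ (o :: h) = V θ d :=
          (M.value_congr_of_not_conforms hdc h2.symm θ).symm
        rw [h3, h1]
        simp [payoff]
      have hx0 := x.2.1
      have hx1 : 0 ≤ 1 - (x : ℝ) := sub_nonneg.mpr x.2.2
      have hv := M.value_update (cascadeProfile n k) i s θ h
      rw [e, ← hx] at hv
      have h1 := mul_le_mul_of_nonneg_left hr hx0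
      have h2 := mul_le_mul_of_nonneg_left hs hx1
      have h3 := mul_le_mul_of_nonneg_left hlow hx1
      simp only [hV] at *
      rw [hv]
      linarith
    · have hpow : ∀ l, G * (1 - M.π) ^ t * (1 - M.π) ^ l = G * (1 - M.π) ^ (t + l) := fun l => by
        rw [pow_add, mul_assoc]
      have hp : ∀ l < N + 1, 0 ≤ G * (1 - M.π) ^ t * (1 - M.π) ^ l * M.exploreValue .good
          + B * M.exploreValue .bad := fun l hl => by
        rw [hpow]
        exact hpos _ (by omega)
      have h1 := M.soloValue_nonneg hp
      have h2 := M.value_le_soloValue (i := i) s (mul_nonneg hG (pow_nonneg hπ t)) hB hp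
        (by rw [hpow, ht]; exact hneg) hdc
      have hx0 := x.2.1
      have hx1 : 0 ≤ 1 - (x : ℝ) := sub_nonneg.mpr x.2.2
      have h3 := mul_nonpos_of_nonneg_of_nonpos (mul_nonneg hx0 hδ) hS0
      -- After the detected safe action the solo value is still an upper bound, now one period late;
      -- as it is nonnegative, delay cannot help.
      have h4 : M.δ * (G * (1 - M.π) ^ t * V .good d + B * V .bad d)
          ≤ G * (1 - M.π) ^ t * M.soloValue .good (N + 1) + B * M.soloValue .bad (N + 1) :=
        (mul_le_mul_of_nonneg_left h2 hδ).trans (mul_le_of_le_one_left h1 M.δ_lt_one.le)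
      have h5 := mul_le_mul_of_nonneg_left h4 hx1
      rw [pow_succ] at h3
      simp only [successProb]
      linarith

end Params

end SocialBandit

/-! ### Averaging over information sets -/

namespace SocialBandit

namespace Params

variable (M : Params) {n k : ℕ} {i : Fin n}

open Classical in
theorem sum_infoSet (i : Fin n) (I : Info n) (f : State × History n → ℝ) :
    ∑ x ∈ M.infoSet i I, f x
      = (∑ h ∈ histories n I.length, if observe i h = I then f (.good, h) else 0)
        + ∑ h ∈ histories n I.length,
            if M.IsNode .bad h ∧ observe i h = I then f (.bad, h) else 0 := by
  rw [infoSet, Finset.sum_filter, Finset.sum_product, sum_state]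
  simp [isNode_good]

open Classical in
/-- Probability, in the good state, of the information after `t` periods without any observed
success. -/
noncomputable def failureProb (k : ℕ) (i : Fin n) (t : ℕ) : ℝ :=
  ∑ h ∈ histories n t, if observe i h = observe i (failureHistory n k t)
    then M.reachProb (cascadeProfile n k) .good h else 0

theorem observe_cons_eq {o : Fin n → Outcome} {h : History n} {t : ℕ}
    (e : observe i (o :: h) = observe i (failureHistory n k (t + 1))) :
    o i = (if t < k then Outcome.low else Outcome.safe) ∧
      observe i h = observe i (failureHistory n k t) := by
  rw [failureHistory, observe_cons, observe_cons] at e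
  exact ⟨congrArg Prod.snd (List.cons.inj e).1, (List.cons.inj e).2⟩

theorem failureProb_nonneg (k : ℕ) (i : Fin n) (t : ℕ) : 0 ≤ M.failureProb k i t :=
  Finset.sum_nonneg fun h _ => by
    split_ifs
    · exact M.reachProb_nonneg _ _ _
    · exact le_rfl

/-- Before the cutoff all agents play risky in any case, so only the agent's own draw is
informative. -/
theorem failureProb_succ_of_lt {t : ℕ} (ht : t < k) :
    M.failureProb k i (t + 1) = M.failureProb k i t * (1 - M.π) := by
  rw [failureProb, failureProb, sum_histories_succ, Finset.sum_mul]
  refine Finset.sum_congr rfl fun h hh => ?_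
  have hl : h.length < k := by rwa [(mem_histories t h).mp hh]
  split_ifs with e
  · let g : Outcome → ℝ := fun y => match y with | .safe => 0 | .high => 0 | .low => 1
    have h1 := M.expect_risky (cascadeProfile n k) .good h i (cascadeProfile_of_lt hl) g
    simp only [g, successProb, mul_zero, mul_one, zero_add] at h1
    rw [← h1, Finset.mul_sum]
    refine Finset.sum_congr rfl fun o _ => ?_
    by_cases ho : M.stepProb (cascadeProfile n k) .good h o = 0
    · simp [reachProb, ho]
    · have hr := fun j => M.act_of_stepProb (cascadeProfile_of_lt hl (i := j)) ho
      have h2 : observe i (o :: h) = observe i (failureHistory n k (t + 1)) ↔ o i = .low := by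
        refine ⟨fun e' => by simpa [ht] using (observe_cons_eq e').1, fun hy => ?_⟩
        rw [failureHistory, observe_cons, observe_cons, e]
        simp only [if_pos ht, hr, hy]
        rfl
      simp only [h2, reachProb]
      cases hy : o i <;> simp
  · rw [zero_mul]
    exact Finset.sum_eq_zero fun o _ => if_neg fun e' => e (observe_cons_eq e').2

/-- From the cutoff on, continued conformity also means that no other agent reveals a success, so
the weight of the good state can only fall. -/
theorem failureProb_succ_le (t : ℕ) : M.failureProb k i (t + 1) ≤ M.failureProb k i t := by
  rw [failureProb, failureProb, sum_histories_succ]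
  refine Finset.sum_le_sum fun h _ => ?_
  split_ifs with e
  · rw [← mul_one (M.reachProb (cascadeProfile n k) .good h),
      ← M.sum_stepProb (cascadeProfile n k) .good h, Finset.mul_sum]
    refine Finset.sum_le_sum fun o _ => ?_
    split_ifs
    · exact le_rfl
    · exact mul_nonneg (M.reachProb_nonneg _ _ _) (M.stepProb_nonneg _ _ _ _)
  · exact (Finset.sum_eq_zero fun o _ => if_neg fun e' => e (observe_cons_eq e').2).le

theorem failureProb_of_le {t : ℕ} (ht : t ≤ k) : M.failureProb k i t = (1 - M.π) ^ t := by
  induction t with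
  | zero => simp [failureProb, histories, failureHistory, reachProb]
  | succ t ih => rw [M.failureProb_succ_of_lt (by omega), ih (by omega), pow_succ]

theorem failureProb_le {t : ℕ} (ht : k ≤ t) : M.failureProb k i t ≤ (1 - M.π) ^ k := by
  induction t, ht using Nat.le_induction with
  | base => exact (M.failureProb_of_le le_rfl).le
  | succ t _ ih => exact (M.failureProb_succ_le t).trans ih

theorem eq_failureHistory_of_isNode_bad {h : History n} {t : ℕ} (hn : M.IsNode .bad h)
    (e : observe i h = observe i (failureHistory n k t)) : h = failureHistory n k t := by
  have h1 := eq_failureHistory (canStop_observe.mp (canStop_of_observe_eq e)).1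
    (M.allFailures_of_isNode_bad hn)
  rwa [length_eq_of_observe e, length_failureHistory] at h1

theorem isNode_failureHistory (θ : State) (k t : ℕ) : M.IsNode θ (failureHistory n k t) := by
  induction t with
  | zero => simp [IsNode, failureHistory]
  | succ t ih =>
    refine M.isNode_cons.mpr ⟨fun j => ?_, ih⟩
    split_ifs
    · simpa [chance] using M.successProb_lt_one θ
    · simp [chance]

open Classical in
theorem sum_bad_failureHistory (k : ℕ) (i : Fin n) (t : ℕ) :
    (∑ h ∈ histories n t, if M.IsNode .bad h ∧ observe i h = observe i (failureHistory n k t)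
      then M.reachProb (cascadeProfile n k) .bad h else 0) = 1 := by
  rw [Finset.sum_eq_single (failureHistory n k t)]
  · rw [if_pos ⟨M.isNode_failureHistory _ k t, rfl⟩, reachProb_bad_failureHistory]
  · intro h _ hne
    exact if_neg fun e => hne (M.eq_failureHistory_of_isNode_bad e.1 e.2)
  · intro hh
    exact absurd ((mem_histories t _).mpr (length_failureHistory k t)) hh

theorem infoProb_failureHistory (q : ℝ) (k : ℕ) (i : Fin n) (t : ℕ) :
    M.infoProb q (cascadeProfile n k) i (observe i (failureHistory n k t))
      = q * M.failureProb k i t + (1 - q) := by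
  classical
  have hb := congrArg ((1 - q) * ·) (M.sum_bad_failureHistory k i t)
  simp only [Finset.mul_sum, mul_ite, mul_zero, mul_one] at hb
  rw [infoProb, sum_infoSet, failureProb, Finset.mul_sum, length_observe, length_failureHistory]
  simp only [mul_ite, mul_zero, priorWeight]
  rw [hb]

/-- At any information without an observed success, no deviation is profitable on average. -/
theorem sum_deviation_nonpos {q : ℝ} (hq0 : 0 ≤ q) (hq1 : q ≤ 1) (s : Info n → unitInterval)
    (hpos : ∀ l < k, 0 ≤ q * (1 - M.π) ^ l * M.exploreValue .good
      + (1 - q) * M.exploreValue .bad)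
    (hneg : q * (1 - M.π) ^ k * M.exploreValue .good + (1 - q) * M.exploreValue .bad ≤ 0)
    (t : ℕ) :
    ∑ x ∈ M.infoSet i (observe i (failureHistory n k t)),
      priorWeight q x.1 * M.reachProb (cascadeProfile n k) x.1 x.2 *
        (M.value (Function.update (cascadeProfile n k) i s) i x.1 x.2
          - M.value (cascadeProfile n k) i x.1 x.2) ≤ 0 := by
  classical
  have hπ : 0 ≤ 1 - M.π := by linarith [M.π_lt_one]
  have hB : 0 ≤ 1 - q := by linarith
  obtain ⟨S, hS, hS0⟩ : ∃ S : State → ℝ,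
      (∀ θ h, M.IsNode θ h → observe i h = observe i (failureHistory n k t) →
        M.reachProb (cascadeProfile n k) θ h ≠ 0 →
        M.value (Function.update (cascadeProfile n k) i s) i θ h
          - M.value (cascadeProfile n k) i θ h ≤ S θ) ∧
      q * M.failureProb k i t * S .good + (1 - q) * S .bad ≤ 0 := by
    rcases le_or_gt t k with ht | ht
    · obtain ⟨S, hS, hS0⟩ := M.exists_deviation_bound (i := i) s hq0 hB hpos hneg
        (Nat.add_sub_cancel' ht)
      rw [M.failureProb_of_le ht]
      exact ⟨S, fun θ h hn e _ => hS θ h hn e, hS0⟩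
    -- Past the cutoff the only reachable node is the common failure history, where the profile
    -- yields 0. The weight of the good state is at most that after `k` failures, so exploring
    -- remains unprofitable.
    · refine ⟨fun θ => M.value (Function.update (cascadeProfile n k) i s) i θ
        (failureHistory n k t), fun θ h hn e hr => ?_, ?_⟩
      · have hl : h.length = t := by simpa using length_eq_of_observe e
        have hc := (canStop_observe.mp (canStop_of_observe_eq e)).1
        have h1 := eq_failureHistory hc (M.allFailures_of_reachProb (by omega) hc hr)
        rw [hl] at h1
        rw [h1, M.value_cascade_stopped θ ht.le, sub_zero]
      · refine M.value_nonpos_of_stopped s ht.le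
          (mul_nonneg hq0 (M.failureProb_nonneg k i t)) hB (le_trans ?_ hneg)
        gcongr
        · exact M.exploreValue_good_pos.le
        · exact M.failureProb_le ht.le
  have hw : ∀ x : State × History n,
      0 ≤ priorWeight q x.1 * M.reachProb (cascadeProfile n k) x.1 x.2 := by
    rintro ⟨θ, h⟩
    refine mul_nonneg ?_ (M.reachProb_nonneg _ _ _)
    cases θ
    · exact hq0
    · exact hB
  refine le_trans (Finset.sum_le_sum (g := fun x =>
    priorWeight q x.1 * M.reachProb (cascadeProfile n k) x.1 x.2 * S x.1) fun x hx => ?_) ?_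
  · rw [mem_infoSet] at hx
    by_cases hr : M.reachProb (cascadeProfile n k) x.1 x.2 = 0
    · simp [hr]
    · exact mul_le_mul_of_nonneg_left (hS x.1 x.2 hx.1 hx.2 hr) (hw x)
  · refine le_trans (le_of_eq ?_) hS0
    have hb := congrArg ((1 - q) * · * S .bad) (M.sum_bad_failureHistory k i t)
    simp only [Finset.mul_sum, Finset.sum_mul, mul_ite, ite_mul, mul_zero, zero_mul, mul_one] at hb
    rw [sum_infoSet, length_observe, length_failureHistory, failureProb]
    simp only [Finset.mul_sum, Finset.sum_mul, mul_ite, ite_mul, mul_zero, zero_mul, priorWeight]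
    rw [hb]

/-! ### The equilibrium -/

open Classical in
/-- Bayes' rule where it applies; at unexpected information, the agents believe in the good
state. -/
noncomputable def optimisticBelief (p : Fin n → ℝ) (σ : Profile n) : BeliefSystem n :=
  fun i I x =>
    if 0 < M.infoProb (p i) σ i I then
      priorWeight (p i) x.1 * M.reachProb σ x.1 x.2 / M.infoProb (p i) σ i I
    else if hI : ∃ h, observe i h = I then
      if x = (.good, hI.choose) then 1 else 0
    else 0

theorem optimisticBelief_of_pos {p : Fin n → ℝ} {σ : Profile n} {I : Info n}
    (hP : 0 < M.infoProb (p i) σ i I) (x : State × History n) :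
    M.optimisticBelief p σ i I x
      = priorWeight (p i) x.1 * M.reachProb σ x.1 x.2 / M.infoProb (p i) σ i I := by
  rw [optimisticBelief, if_pos hP]

theorem optimisticBelief_bad {p : Fin n → ℝ} {σ : Profile n} {I : Info n}
    (hP : ¬ 0 < M.infoProb (p i) σ i I) (h : History n) :
    M.optimisticBelief p σ i I (.bad, h) = 0 := by
  rw [optimisticBelief, if_neg hP]
  split_ifs with h1 h2
  · simp at h2
  · rfl
  · rfl

theorem isBeliefSystem_optimisticBelief {p : Fin n → ℝ} (hp : ∀ i, p i ∈ Set.Ioo (0 : ℝ) 1)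
    (σ : Profile n) : M.IsBeliefSystem (M.optimisticBelief p σ) := by
  rintro i I ⟨x₀, hx₀⟩
  by_cases hP : 0 < M.infoProb (p i) σ i I
  · simp only [M.optimisticBelief_of_pos hP]
    refine ⟨fun x _ => div_nonneg (mul_nonneg ?_ (M.reachProb_nonneg _ _ _)) hP.le, ?_⟩
    · cases x.1
      · exact (hp i).1.le
      · exact sub_nonneg.mpr (hp i).2.le
    · rw [← Finset.sum_div]
      exact div_self hP.ne'
  · have hI : ∃ h, observe i h = I := ⟨x₀.2, (M.mem_infoSet.mp hx₀).2⟩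
    classical
    have key : ∀ x, M.optimisticBelief p σ i I x
        = if x = (State.good, hI.choose) then 1 else 0 := fun x => by
      rw [optimisticBelief, if_neg hP, dif_pos hI]
    simp only [key]
    refine ⟨fun x _ => by split_ifs <;> norm_num, ?_⟩
    rw [Finset.sum_ite_eq', if_pos]
    exact M.mem_infoSet.mpr ⟨M.isNode_good _, hI.choose_spec⟩

/-- An agent who is sure of the good state and plays risky forever cannot do better. -/
theorem expectedValue_le_of_optimistic {μ : BeliefSystem n} (hμ : M.IsBeliefSystem μ) {I : Info n}
    (hI : (M.infoSet i I).Nonempty) (hc : ¬ CanStop k I)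
    (hbad : ∀ h, (State.bad, h) ∈ M.infoSet i I → μ i I (.bad, h) = 0)
    (s : Info n → unitInterval) :
    M.expectedValue (Function.update (cascadeProfile n k) i s) i I (μ i I)
      ≤ M.expectedValue (cascadeProfile n k) i I (μ i I) := by
  refine Finset.sum_le_sum ?_
  rintro ⟨θ, h⟩ hx
  cases θ with
  | bad => rw [hbad h hx, zero_mul, zero_mul]
  | good =>
    refine mul_le_mul_of_nonneg_left ?_ ((hμ i I hI).1 _ hx)
    rw [M.value_cascade_of_not_canStop (k := k) (by rwa [(M.mem_infoSet.mp hx).2])]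
    exact M.value_good_le _ _ _

/-- Information with `CanStop` is always reached with positive probability, so Bayes' rule and the
averaged deviation bound apply. At any other information the belief excludes the bad state, by
Bayes' rule or by optimism, and risky play forever is optimal. -/
theorem isWeakPBE_cascadeProfile {p : Fin n → ℝ} (hp : ∀ i, p i ∈ Set.Ioo (0 : ℝ) 1)
    (hpos : ∀ i, ∀ l < k, 0 ≤ p i * (1 - M.π) ^ l * M.exploreValue .good
      + (1 - p i) * M.exploreValue .bad)
    (hneg : ∀ i, p i * (1 - M.π) ^ k * M.exploreValue .good
      + (1 - p i) * M.exploreValue .bad ≤ 0) :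
    M.IsWeakPBE p (cascadeProfile n k) (M.optimisticBelief p (cascadeProfile n k)) := by
  have hμ := M.isBeliefSystem_optimisticBelief hp (cascadeProfile n k)
  refine ⟨hμ, fun i I hP x _ => M.optimisticBelief_of_pos hP x, fun i I hI s => ?_⟩
  by_cases hc : CanStop k I
  · obtain ⟨⟨θ, h⟩, hx⟩ := hI
    have hh := (M.mem_infoSet.mp hx).2
    dsimp only at hh
    have hI : I = observe i (failureHistory n k h.length) := by
      rw [← hh] at hc ⊢
      exact observe_eq_failureHistory hc
    have hP : 0 < M.infoProb (p i) (cascadeProfile n k) i I := by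
      rw [hI, infoProb_failureHistory]
      have h1 := mul_nonneg (hp i).1.le (M.failureProb_nonneg k i h.length)
      linarith [(hp i).2]
    have h1 := M.sum_deviation_nonpos (i := i) (hp i).1.le (hp i).2.le s (hpos i) (hneg i) h.length
    rw [← hI] at h1
    rw [← sub_nonpos, expectedValue, expectedValue, ← Finset.sum_sub_distrib]
    simp only [M.optimisticBelief_of_pos hP, ← mul_sub]
    simp_rw [div_mul_eq_mul_div]
    rw [← Finset.sum_div]
    exact div_nonpos_of_nonpos_of_nonneg h1 hP.le
  · refine M.expectedValue_le_of_optimistic hμ hI hc (fun h hx => ?_) s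
    by_cases hP : 0 < M.infoProb (p i) (cascadeProfile n k) i I
    · have hx' := M.mem_infoSet.mp hx
      dsimp only at hx'
      rw [M.optimisticBelief_of_pos hP]
      have : M.reachProb (cascadeProfile n k) .bad h = 0 := by
        by_contra hr
        apply hc
        rw [← hx'.2, canStop_observe]
        exact ⟨M.conforms_of_reachProb_bad hx'.1 hr, M.allFailures_of_isNode_bad hx'.1 i⟩
      rw [this, mul_zero, zero_div]
    · exact M.optimisticBelief_bad hP h

/-! ### Generic priors -/

/-- Value of exploring once more, weighted with the probabilities of the two states and of `k`
failures. -/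
def exploreGain (k : ℕ) (q : ℝ) : ℝ :=
  q * (1 - M.π) ^ k * M.exploreValue .good + (1 - q) * M.exploreValue .bad

theorem exploreGain_pos_iff {k : ℕ} {q : ℝ} (hq : q ∈ Set.Ioo (0 : ℝ) 1) :
    0 < M.exploreGain k q ↔ M.cutoffBelief < M.failureBelief k q := by
  have h1 : 0 < (1 - M.π) ^ k := pow_pos (by linarith [M.π_lt_one]) k
  have h2 := M.E1_pos
  have h3 := M.E0_pos
  have h4 := M.δ_pos
  have h5 := M.π_pos
  have h6 : 0 < 1 - M.δ := by linarith [M.δ_lt_one]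
  have h7 := hq.1
  have h8 : 0 < 1 - q := by linarith [hq.2]
  rw [cutoffBelief, failureBelief, div_lt_div_iff₀ (by positivity) (by positivity), exploreGain,
    exploreValue_good, exploreValue_bad, ← sub_pos (b := (1 - M.δ) * M.E0 * _)]
  refine iff_of_eq (congrArg _ ?_)
  ring

theorem exploreGain_neg_iff {k : ℕ} {q : ℝ} (hq : q ∈ Set.Ioo (0 : ℝ) 1) :
    M.exploreGain k q < 0 ↔ M.failureBelief k q < M.cutoffBelief := by
  have h1 : 0 < (1 - M.π) ^ k := pow_pos (by linarith [M.π_lt_one]) k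
  have h2 := M.E1_pos
  have h3 := M.E0_pos
  have h4 := M.δ_pos
  have h5 := M.π_pos
  have h6 : 0 < 1 - M.δ := by linarith [M.δ_lt_one]
  have h7 := hq.1
  have h8 : 0 < 1 - q := by linarith [hq.2]
  rw [cutoffBelief, failureBelief, div_lt_div_iff₀ (by positivity) (by positivity), exploreGain,
    exploreValue_good, exploreValue_bad, ← sub_neg (b := (1 - M.δ) * M.E0 * _)]
  refine iff_of_eq (congrArg (· < (0 : ℝ)) ?_)
  ring

theorem exploreGain_eq_zero_iff {k : ℕ} {q : ℝ} (hq : q ∈ Set.Ioo (0 : ℝ) 1) :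
    M.exploreGain k q = 0 ↔ M.failureBelief k q = M.cutoffBelief := by
  have h1 := M.exploreGain_pos_iff (k := k) hq
  have h2 := M.exploreGain_neg_iff (k := k) hq
  constructor
  · intro e
    exact le_antisymm (not_lt.mp fun c => (h1.mpr c).ne' e) (not_lt.mp fun c => (h2.mpr c).ne e)
  · intro e
    exact le_antisymm (not_lt.mp fun c => (h1.mp c).ne' e) (not_lt.mp fun c => (h2.mp c).ne e)

theorem exploreValue_bad_neg : M.exploreValue .bad < 0 := by
  rw [exploreValue_bad]
  have := mul_pos (sub_pos.mpr M.δ_lt_one) M.E0_pos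
  linarith

theorem exploreGain_strictMono (k : ℕ) : StrictMono (M.exploreGain k) := by
  intro a b hab
  have h1 : 0 < (1 - M.π) ^ k * M.exploreValue .good :=
    mul_pos (pow_pos (by linarith [M.π_lt_one]) k) M.exploreValue_good_pos
  have h2 := mul_lt_mul_of_pos_right hab h1
  have h3 := mul_lt_mul_of_neg_right hab M.exploreValue_bad_neg
  simp only [exploreGain]
  linarith

theorem continuous_exploreGain (k : ℕ) : Continuous (M.exploreGain k) := by
  unfold exploreGain
  fun_prop

theorem exists_exploreGain_neg {q : ℝ} (hq : q < 1) : ∃ k, M.exploreGain k q < 0 := by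
  have h1 : Filter.Tendsto (fun k => M.exploreGain k q) Filter.atTop
      (nhds (q * 0 * M.exploreValue .good + (1 - q) * M.exploreValue .bad)) :=
    (((tendsto_pow_atTop_nhds_zero_of_lt_one (by linarith [M.π_lt_one])
      (by linarith [M.π_pos])).const_mul q).mul_const _).add_const _
  refine (h1.eventually_lt_const ?_).exists
  have := mul_neg_of_pos_of_neg (sub_pos.mpr hq) M.exploreValue_bad_neg
  simpa using this

theorem countable_not_isGeneric :
    {q : ℝ | q ∈ Set.Ioo (0 : ℝ) 1 ∧ ¬ M.IsGeneric q}.Countable := by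
  -- Each `k` rules out at most one prior, because the gain is strictly increasing in the prior.
  refine (Set.countable_iUnion fun k : ℕ =>
    (show {q : ℝ | M.exploreGain k q = 0}.Subsingleton from fun a ha b hb =>
      (M.exploreGain_strictMono k).injective (ha.trans hb.symm)).countable).mono ?_
  rintro q ⟨hq, hg⟩
  obtain ⟨k, hk⟩ := not_forall_not.mp hg
  exact Set.mem_iUnion.mpr ⟨k, (M.exploreGain_eq_zero_iff hq).mpr hk⟩

/-- Near a generic prior, the number of explorations in the solo problem is constant. -/
theorem exists_constant_cutoff {q : ℝ} (hq : q ∈ Set.Ioo (0 : ℝ) 1) (hg : M.IsGeneric q) :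
    ∃ k : ℕ, ∃ ε > 0, ∀ r, dist r q < ε → r ∈ Set.Ioo (0 : ℝ) 1 ∧
      (∀ l < k, 0 ≤ M.exploreGain l r) ∧ M.exploreGain k r ≤ 0 := by
  classical
  have hex := M.exists_exploreGain_neg hq.2
  -- Minimality gives weak inequalities; genericity makes them strict and hence stable under small
  -- changes of the prior.
  have hpos : ∀ l < Nat.find hex, 0 < M.exploreGain l q := fun l hl =>
    lt_of_le_of_ne (not_lt.mp (Nat.find_min hex hl))
      fun e => hg l ((M.exploreGain_eq_zero_iff hq).mp e.symm)
  have h1 : ∀ᶠ r in nhds q, ∀ l ∈ Finset.range (Nat.find hex), 0 < M.exploreGain l r :=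
    (Finset.eventually_all _).mpr fun l hl =>
      (M.continuous_exploreGain l).continuousAt.eventually_const_lt
        (hpos l (Finset.mem_range.mp hl))
  have h2 := (M.continuous_exploreGain (Nat.find hex)).continuousAt.eventually_lt_const
    (Nat.find_spec hex)
  obtain ⟨ε, hε, H⟩ := Metric.eventually_nhds_iff.mp
    (Filter.Eventually.and (Ioo_mem_nhds hq.1 hq.2) (h1.and h2))
  refine ⟨Nat.find hex, ε, hε, fun r hr => ?_⟩
  obtain ⟨a, b, c⟩ := H hr
  exact ⟨a, fun l hl => (b l (Finset.mem_range.mpr hl)).le, c.le⟩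

end Params

end SocialBandit

theorem proposition2 (M : SocialBandit.Params) (n : ℕ)
    (hineq : M.E1 / M.E0 ≥
      (1 - M.π) / (M.δ + M.π - (1 - M.π) * (1 + M.δ * M.π / (1 - M.δ)))) :
    {q : ℝ | q ∈ Set.Ioo (0 : ℝ) 1 ∧ ¬ M.IsGeneric q}.Countable ∧
    ∀ q ∈ Set.Ioo (0 : ℝ) 1, M.IsGeneric q →
      ∃ ε > 0, ∀ p ∈ Metric.ball (fun _ : Fin n => q) ε,
        (∀ i, p i ∈ Set.Ioo (0 : ℝ) 1) ∧
        ∃ σ : SocialBandit.Profile n, M.IsCascadeEquilibrium p σ := by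
  refine ⟨M.countable_not_isGeneric, fun q hq hg => ?_⟩
  obtain ⟨k, ε, hε, H⟩ := M.exists_constant_cutoff hq hg
  refine ⟨ε, hε, fun p hp => ?_⟩
  have hd : ∀ i, dist (p i) q < ε := fun i =>
    (dist_le_pi_dist p (fun _ => q) i).trans_lt (Metric.mem_ball.mp hp)
  have hp01 := fun i => (H (p i) (hd i)).1
  exact ⟨hp01, SocialBandit.cascadeProfile n k,
    ⟨_, M.isWeakPBE_cascadeProfile hp01 (fun i => (H (p i) (hd i)).2.1)
      fun i => (H (p i) (hd i)).2.2⟩,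
    _, M.inducesCascade_cascadeProfile n k⟩
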